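/- Let $T$ be a complete first-order theory. A formula $\varphi(x,y)$ ($x,y$ finite tuples of variables) has TP$_2$ if there are an array $(a_{i,j})_{i,j<\omega}$ in a model of $T$ and $k<\omega$ such that $\{\varphi(x,a_{i,\eta(i)}) : i<\omega\}$ is consistent for every $\eta:\omega\to\omega$, and for every $i<\omega$ the family $(\varphi(x,a_{i,j}))_{j<\omega}$ is $k$-inconsistent (no $k$ of its members, counted by index, are jointly realized). $T$ is NTP$_2$ if no formula has TP$_2$. A Keisler measure over a model $M$ in a finite tuple of variables $x$ is a finitely additive probability measure on the Boolean algebra of sets in the variable $x$ definable with parameters from $M$. For $A\subseteq M$, a formula $\varphi(x,b)$ with $b$ in $M$ divides over $A$ if in some elementary extension of $M$ there is an $A$-indiscernible sequence $(b_i)_{i<\omega}$ with $b_0=b$ such that $(\varphi(x,b_i))_{i<\omega}$ is $k$-inconsistent for some $k<\omega$. A Keisler measure $\nu$ over a model $N$ is NTP$_2$-smooth if for every elementary extension $N'\succeq N$ and every Keisler measure $\nu'$ over $N'$ extending $\nu$, $\nu'(\varphi(x,b))=0$ for every formula $\varphi(x,b)$ with parameters $b$ in $N'$ that divides over $N$.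 Theorem. Suppose $T$ is NTP$_2$ and $M\models T$. Then every Keisler measure $\mu$ over $M$ in a finite tuple of variables $x$ extends to an NTP$_2$-smooth Keisler measure $\nu$ (in the same variables $x$) over some elementary extension $N\succeq M$. -/

import Mathlib

open FirstOrder

universe u v w w'

namespace KeislerNTP2

open FirstOrder.Language

variable {L : FirstOrder.Language.{u, v}}

section Formulas

variable {M : Type w} [L.Structure M] {n m : ℕ} {ι : Type*}

/-- The family `{φ(x, a i) | i}` of instances of `φ(x, y)` with parameters in the structure `M` is
consistent: every finite subfamily is realized in `M`. (By compactness, this says that the whole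
family is realized in some elementary extension of `M`.) -/
def ConsistentFamily (φ : L.Formula (Fin n ⊕ Fin m)) (a : ι → Fin m → M) : Prop :=
  ∀ s : Finset ι, ∃ x : Fin n → M, ∀ i ∈ s, φ.Realize (Sum.elim x (a i))

/-- The family `{φ(x, a i) | i}` is `k`-inconsistent: no `k` of its members (counted by their
indices) have a common realization. -/
def KInconsistent (φ : L.Formula (Fin n ⊕ Fin m)) (k : ℕ) (a : ι → Fin m → M) : Prop :=
  ∀ s : Finset ι, s.card = k → ¬ ∃ x : Fin n → M, ∀ i ∈ s, φ.Realize (Sum.elim x (a i))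

variable (L) in
/-- The sequence `(c i)_{i < ω}` of `m`-tuples is indiscernible over the set `A`: any two increasing
finite subsequences of the same length satisfy the same formulas with parameters from `A`. -/
def IndiscernibleOver (A : Set M) (c : ℕ → Fin m → M) : Prop :=
  ∀ (r : ℕ) (ψ : L.Formula (A ⊕ (Fin r × Fin m))) (i j : Fin r → ℕ),
    StrictMono i → StrictMono j →
      (ψ.Realize (Sum.elim (fun a : A => (a : M)) (fun p => c (i p.1) p.2)) ↔
        ψ.Realize (Sum.elim (fun a : A => (a : M)) (fun p => c (j p.1) p.2)))

/-- `φ(x, b)`, with `b` a tuple of the model `M`, divides over `A ⊆ M`: in some elementary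
extension of `M` there is a sequence which is indiscernible over `A`, starts with `b`, and
makes the instances of `φ` `k`-inconsistent for some `k`. (By the downward Löwenheim-Skolem theorem
it does not matter that the elementary extension lives in a fixed universe.) -/
def Divides (A : Set M) (φ : L.Formula (Fin n ⊕ Fin m)) (b : Fin m → M) : Prop :=
  ∃ (P : Type (max u v w)) (_ : L.Structure P) (f : M ↪ₑ[L] P) (c : ℕ → Fin m → P) (k : ℕ),
    c 0 = f ∘ b ∧ IndiscernibleOver L (f '' A) c ∧ KInconsistent φ k c

end Formulas

/-- `φ(x, y)` has the tree property of the second kind in (models of) `T`. -/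
def HasTP2 (T : L.Theory) {n m : ℕ} (φ : L.Formula (Fin n ⊕ Fin m)) : Prop :=
  ∃ (M : Theory.ModelType.{u, v, max u v} T) (a : ℕ → ℕ → Fin m → M) (k : ℕ),
    (∀ η : ℕ → ℕ, ConsistentFamily φ (fun i => a i (η i))) ∧ ∀ i, KInconsistent φ k (a i)

/-- No formula has the tree property of the second kind in `T`. -/
def IsNTP2 (T : L.Theory) : Prop :=
  ∀ (n m : ℕ) (φ : L.Formula (Fin n ⊕ Fin m)), ¬ HasTP2 T φ

/-- The set `φ(M, b)` of realizations of `φ(x, b)` in `M`, as an element of the Boolean algebra of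
subsets of `M ^ n` that are definable with parameters from `M`. -/
def definedBy {M : Type w} [L.Structure M] {n m : ℕ} (φ : L.Formula (Fin n ⊕ Fin m))
    (b : Fin m → M) : L.DefinableSet (Set.univ : Set M) (Fin n) :=
  ⟨{x | φ.Realize (Sum.elim x b)}, by
    rw [Set.definable_iff_exists_formula_sum]
    refine ⟨φ.relabel (Sum.elim Sum.inr (fun j => Sum.inl ⟨b j, Set.mem_univ _⟩)), ?_⟩
    ext x
    simp only [Set.mem_ofPred_eq, Formula.realize_relabel]
    have h : (Sum.elim (fun a : (Set.univ : Set M) => (a : M)) x) ∘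
        (Sum.elim Sum.inr (fun j => Sum.inl ⟨b j, Set.mem_univ _⟩)) = Sum.elim x b := by
      funext i
      cases i <;> rfl
    rw [h]⟩

variable (L) in
/-- A Keisler measure over the structure `M` in a variable `x` of length `n`: a finitely additive
probability measure on the Boolean algebra of subsets of `M ^ n` definable with parameters
from `M`. -/
structure KeislerMeasure (M : Type w) [L.Structure M] (n : ℕ) where
  /-- The measure of a definable set. -/
  toFun : L.DefinableSet (Set.univ : Set M) (Fin n) → ℝ
  nonneg : ∀ X, 0 ≤ toFun X
  map_top : toFun ⊤ = 1
  map_sup : ∀ X Y, Disjoint X Y → toFun (X ⊔ Y) = toFun X + toFun Y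

namespace KeislerMeasure

/-- `ν` extends `μ`, where `M` is regarded as an elementary substructure of `N` through `f`. -/
def Extends {M : Type w} {N : Type w'} [L.Structure M] [L.Structure N] {n : ℕ}
    (ν : KeislerMeasure L N n) (f : M ↪ₑ[L] N) (μ : KeislerMeasure L M n) : Prop :=
  ∀ (m : ℕ) (φ : L.Formula (Fin n ⊕ Fin m)) (b : Fin m → M),
    ν.toFun (definedBy φ (f ∘ b)) = μ.toFun (definedBy φ b)

/-- `ν`, a Keisler measure over `N`, is NTP₂-smooth: every extension of `ν` to an elementary
extension `N'` of `N` gives measure zero to every formula `φ(x, b)`, `b` in `N'`, that divides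
over `N`. -/
def IsNTP2Smooth {N : Type w} [L.Structure N] {n : ℕ} (ν : KeislerMeasure L N n) : Prop :=
  ∀ (N' : Type (max u v w)) [L.Structure N'] (g : N ↪ₑ[L] N') (ν' : KeislerMeasure L N' n),
    ν'.Extends g ν →
      ∀ (m : ℕ) (φ : L.Formula (Fin n ⊕ Fin m)) (b : Fin m → N'),
        Divides (Set.range g) φ b → ν'.toFun (definedBy φ b) = 0

end KeislerMeasure

end KeislerNTP2

/-! A family of instances of φ is k-sparse if no point lies in k of them. `HasLargeSparse ν φ k ε`
fails when, for some K and finitely many definable sets of measure below ε, every k-sparse family of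
K instances has a member inside one of these sets. If it fails for all φ, k and ε > 0, then ν is
NTP₂-smooth: this covering property is first order in parameters from the base, so it persists in
elementary extensions. Along an indiscernible sequence witnessing dividing, some member lies in a
small set over the base, hence by indiscernibility so does the first
(`isNTP2Smooth_of_not_hasLargeSparse`).

Suppose instead that, for fixed φ, k and ε, large sparse families exist for μ and all its
extensions. The hull of a suitable instance in a given finite algebra has measure at least ε, so
some measure agreeing with μ on that algebra gives the instance mass at least ε. Averaging such
measures over instances that hardly charge one another, and passing to an ultraproduct, gives an
extension with a new row of K instances of total mass at least ε, each meeting every old set X in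
mass at most μ(X)/K + δ. After R rows, the union of each row has mass at least ε/k, while a cell
(one instance from each of r rows) has mass O(K⁻ʳ). So for some r rows a proportion of the Kʳ cells
bounded below independently of K is nonempty, and for large K a box argument finds an r × r subarray
all of whose paths are realized (`exists_grid`). Letting r grow yields TP₂, so in an NTP₂ theory
some extension defeats any given φ, k, ε.

To defeat them all at once, Zorn's lemma gives an extension that is existentially closed for
conditions "there are parameters satisfying θ for which certain sets have measure at most a bound"
(`exists_existentially_closed`). The covering property is such a condition, so it descends from a
further extension. -/

namespace KeislerNTP2

open FirstOrder.Language

variable {L : FirstOrder.Language.{u, v}}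

/-! ### Finite combinatorics: overlapping events, boxes in dense sets, independent sets in digraphs.
-/

section Combinatorics

open Finset

/-- Among sufficiently many events of probability at least `c` on average there are `t` whose
intersection has probability bounded below. -/
theorem exists_subset_le_sum_inter {Ω ι : Type*} [DecidableEq ι] (P : Finset Ω) (p : Ω → ℝ)
    (hp : ∀ x ∈ P, 0 ≤ p x) (hp1 : ∑ x ∈ P, p x ≤ 1) (S : Finset ι) (A : ι → Ω → Prop)
    [∀ i x, Decidable (A i x)] (c : ℝ) (hc : 0 < c) (t : ℕ) (hS : 2 * t ≤ c * S.card)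
    (hA : c * S.card ≤ ∑ i ∈ S, ∑ x ∈ P with A i x, p x) (hne : 0 < S.card) :
    ∃ T ⊆ S, T.card = t ∧ c / 2 / 2 ^ S.card ≤ ∑ x ∈ P with ∀ i ∈ T, A i x, p x := by
  classical
  have h1 : ∑ i ∈ S, ∑ x ∈ P with A i x, p x = ∑ x ∈ P, (S.filter (A · x)).card * p x := by
    simp_rw [Finset.sum_filter]
    rw [Finset.sum_comm]
    refine Finset.sum_congr rfl fun x _ => ?_
    rw [← Finset.sum_filter, Finset.sum_const, nsmul_eq_mul]
  -- B is the set of points lying in at least `t` events. A point of B is counted at most `S.card`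
  -- times and any other point at most `t` times, which forces B to have mass at least `c / 2`.
  set B := P.filter (fun x => t ≤ (S.filter (A · x)).card) with hB
  have h2 : ∑ x ∈ P, ((S.filter (A · x)).card : ℝ) * p x ≤
      S.card * (∑ x ∈ B, p x) + t * ∑ x ∈ P, p x := by
    rw [hB, Finset.sum_filter, Finset.mul_sum, Finset.mul_sum, ← Finset.sum_add_distrib]
    refine Finset.sum_le_sum fun x hx => ?_
    have hpx := hp x hx
    split_ifs with h
    · have : ((S.filter (A · x)).card : ℝ) ≤ S.card := by exact_mod_cast card_filter_le _ _
      nlinarith [(Nat.cast_nonneg t : (0 : ℝ) ≤ t)]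
    · have : ((S.filter (A · x)).card : ℝ) ≤ t := by exact_mod_cast (not_le.1 h).le
      nlinarith
  have hScard : (0 : ℝ) < S.card := by exact_mod_cast hne
  have h3 : c / 2 ≤ ∑ x ∈ B, p x := by
    have : t * ∑ x ∈ P, p x ≤ t := mul_le_of_le_one_right (Nat.cast_nonneg t) hp1
    have h4 : c * S.card ≤ S.card * (∑ x ∈ B, p x) + c * S.card / 2 := by linarith
    have h5 : S.card * (c / 2) ≤ S.card * (∑ x ∈ B, p x) := by linarith
    exact le_of_mul_le_mul_left h5 hScard
  -- The intersections over `t`-element sets of events cover B, and there are at most `2 ^ S.card`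
  -- of them, so one is heavy.
  have h4 : ∑ x ∈ B, p x ≤ ∑ T ∈ S.powersetCard t, ∑ x ∈ P with ∀ i ∈ T, A i x, p x := by
    simp_rw [Finset.sum_filter]
    rw [Finset.sum_comm, hB, Finset.sum_filter]
    refine Finset.sum_le_sum fun x hx => ?_
    have hnn : ∀ T ∈ S.powersetCard t, 0 ≤ if ∀ i ∈ T, A i x then p x else 0 := fun T _ => by
      split_ifs
      · exact hp x hx
      · exact le_rfl
    split_ifs with h
    · obtain ⟨T, hT, hTc⟩ := Finset.exists_subset_card_eq h
      have hTA : ∀ i ∈ T, A i x := fun i hi => (Finset.mem_filter.1 (hT hi)).2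
      have := Finset.single_le_sum hnn
        (Finset.mem_powersetCard.2 ⟨hT.trans (filter_subset _ _), hTc⟩)
      rwa [if_pos hTA] at this
    · exact Finset.sum_nonneg hnn
  by_contra! hcon
  rcases (S.powersetCard t).eq_empty_or_nonempty with he | hne'
  · rw [he, Finset.sum_empty] at h4
    linarith
  · have h6 : ∑ T ∈ S.powersetCard t, (∑ x ∈ P with ∀ i ∈ T, A i x, p x) <
        ∑ T ∈ S.powersetCard t, c / 2 / 2 ^ S.card :=
      Finset.sum_lt_sum_of_nonempty hne' fun T hT =>
        hcon T (mem_powersetCard.1 hT).1 (mem_powersetCard.1 hT).2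
    rw [Finset.sum_const, nsmul_eq_mul] at h6
    have h7 : ((S.powersetCard t).card : ℝ) ≤ 2 ^ S.card := by
      have : (S.powersetCard t).card ≤ S.powerset.card := card_le_card fun T hT => mem_powerset.2 (mem_powersetCard.1 hT).1
      rw [card_powerset] at this
      exact_mod_cast this
    have h8 : ((S.powersetCard t).card : ℝ) * (c / 2 / 2 ^ S.card) ≤ c / 2 := by
      rw [mul_div_assoc', div_le_iff₀ (by positivity), mul_comm]
      exact mul_le_mul_of_nonneg_left h7 (by positivity)
    linarith

/-- A dense subset of a finite power contains a large grid. -/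
theorem exists_grid_subset (t : ℕ) (r : ℕ) : ∀ c : ℝ, 0 < c → ∃ K₀ : ℕ, ∀ K ≥ K₀,
    ∀ C : Finset (Fin r → Fin K), c * (K : ℝ) ^ r ≤ C.card →
      ∃ S : Fin r → Finset (Fin K), (∀ i, (S i).card = t) ∧
        ∀ η : Fin r → Fin K, (∀ i, η i ∈ S i) → η ∈ C := by
  classical
  induction r with
  | zero =>
    intro c hc
    refine ⟨0, fun K _ C hC => ⟨Fin.elim0, fun i => i.elim0, fun η _ => ?_⟩⟩
    have : 0 < C.card := by
      have : (0 : ℝ) < C.card := hc.trans_le (by simpa using hC)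
      exact_mod_cast this
    obtain ⟨x, hx⟩ := Finset.card_pos.1 this
    rwa [Subsingleton.elim η x]
  | succ r ih =>
    intro c hc
    -- Only `s` heavy fibres will be used, with `s` independent of `K`; the density lost in
    -- intersecting `t` of them is then a constant, to which the induction hypothesis applies.
    obtain ⟨s, hs⟩ := exists_nat_ge (2 * t / (c / 2) + 1)
    have hs1 : (1 : ℝ) ≤ s := le_trans (by have : 0 ≤ 2 * t / (c / 2) := by positivity
                                           linarith) hs
    have hs2 : 2 * (t : ℝ) ≤ c / 2 * s := by
      have : 2 * t / (c / 2) ≤ s := by linarith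
      rwa [div_le_iff₀ (by positivity), mul_comm (s : ℝ)] at this
    obtain ⟨K₁, hK₁⟩ := ih (c / 2 / 2 / 2 ^ s) (by positivity)
    obtain ⟨K₂, hK₂⟩ := exists_nat_ge (s / (c / 2))
    refine ⟨max 1 (max K₁ K₂), fun K hK C hC => ?_⟩
    have hKpos : 0 < (K : ℝ) := by
      have : 1 ≤ K := (le_max_left _ _).trans hK
      exact_mod_cast this
    have hKK₁ : K₁ ≤ K := (le_max_left _ _).trans ((le_max_right _ _).trans hK)
    have hKK₂ : (s : ℝ) ≤ c / 2 * K := by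
      have : (K₂ : ℝ) ≤ K := by
        exact_mod_cast (le_max_right _ _).trans ((le_max_right _ _).trans hK)
      have := hK₂.trans this
      rwa [div_le_iff₀ (by positivity), mul_comm] at this
    let fib : Fin K → Finset (Fin r → Fin K) := fun i =>
      Finset.univ.filter fun y => (Fin.cons i y : Fin (r + 1) → Fin K) ∈ C
    have hfibcard : ∑ i, (fib i).card = C.card := by
      rw [← Finset.card_sigma]
      refine Finset.card_bij (fun p _ => Fin.cons p.1 p.2) ?_ ?_ ?_
      · rintro ⟨i, y⟩ h
        simpa [fib] using h
      · rintro ⟨i, y⟩ _ ⟨i', y'⟩ _ h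
        obtain ⟨h1, h2⟩ := Fin.cons_inj.1 h
        subst h1; subst h2; rfl
      · intro z hz
        exact ⟨⟨z 0, Fin.tail z⟩, by simpa [fib] using hz, Fin.cons_self_tail z⟩
    have hfible : ∀ i, ((fib i).card : ℝ) ≤ (K : ℝ) ^ r := fun i => by
      have : (fib i).card ≤ Fintype.card (Fin r → Fin K) := card_le_univ _
      rw [Fintype.card_fun, Fintype.card_fin, Fintype.card_fin] at this
      exact_mod_cast this
    set G := Finset.univ.filter fun i => c / 2 * (K : ℝ) ^ r ≤ (fib i).card with hG
    have hGcard : s ≤ G.card := by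
      have h1 : c * (K : ℝ) ^ (r + 1) ≤ ∑ i, ((fib i).card : ℝ) := by
        rw [← Nat.cast_sum, hfibcard]; exact hC
      have h2 : ∑ i, ((fib i).card : ℝ) ≤
          ∑ i : Fin K, ((if i ∈ G then (K : ℝ) ^ r else 0) + c / 2 * (K : ℝ) ^ r) := by
        refine Finset.sum_le_sum fun i _ => ?_
        split_ifs with h
        · have := hfible i
          have : 0 ≤ c / 2 * (K : ℝ) ^ r := by positivity
          linarith
        · have : ¬ c / 2 * (K : ℝ) ^ r ≤ (fib i).card := by simpa [hG] using h
          linarith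
      rw [Finset.sum_add_distrib, ← Finset.sum_filter, Finset.sum_const, Finset.sum_const,
        Finset.card_univ, Fintype.card_fin, nsmul_eq_mul, nsmul_eq_mul,
        Finset.filter_mem_eq_inter, Finset.univ_inter] at h2
      have hKr : 0 < (K : ℝ) ^ r := by positivity
      have h3 : c / 2 * K * (K : ℝ) ^ r ≤ G.card * (K : ℝ) ^ r := by
        have h4 := h1.trans h2
        rw [pow_succ] at h4
        linarith
      have h5 := hKK₂.trans (le_of_mul_le_mul_right h3 hKr)
      exact_mod_cast h5
    obtain ⟨S, hSG, hSc⟩ := Finset.exists_subset_card_eq hGcard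
    have hKr : 0 < (K : ℝ) ^ r := by positivity
    obtain ⟨T, hTS, hTc, hT⟩ := exists_subset_le_sum_inter (Finset.univ : Finset (Fin r → Fin K))
      (fun _ => ((K : ℝ) ^ r)⁻¹) (fun _ _ => by positivity)
      (by
        rw [Finset.sum_const, Finset.card_univ, Fintype.card_fun, Fintype.card_fin,
          Fintype.card_fin, nsmul_eq_mul, Nat.cast_pow, mul_inv_cancel₀ hKr.ne'])
      S (fun i y => (Fin.cons i y : Fin (r + 1) → Fin K) ∈ C) (c / 2) (by positivity) t
      (by rw [hSc]; exact hs2)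
      (by
        rw [mul_comm, ← nsmul_eq_mul, ← Finset.sum_const]
        refine Finset.sum_le_sum fun i hi => ?_
        rw [Finset.sum_const, nsmul_eq_mul, ← div_eq_mul_inv, le_div_iff₀ hKr]
        exact (Finset.mem_filter.1 (hSG hi)).2)
      (by rw [hSc]; exact_mod_cast hs1)
    rw [Finset.sum_const, nsmul_eq_mul, ← div_eq_mul_inv, le_div_iff₀ hKr, hSc] at hT
    obtain ⟨S', hS'c, hS'⟩ := hK₁ K hKK₁
      (Finset.univ.filter fun y => ∀ i ∈ T, (Fin.cons i y : Fin (r + 1) → Fin K) ∈ C)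
      (hT.trans_eq (by congr!))
    refine ⟨Fin.cons T S', Fin.cases hTc hS'c, fun η hη => ?_⟩
    have h1 := hS' (Fin.tail η) fun i => hη i.succ
    have h2 := (Finset.mem_filter.1 h1).2 (η 0) (hη 0)
    rwa [Fin.cons_self_tail] at h2

/-- A finite digraph with out-degrees at most `d` and with at least `(2 d + 1) K` vertices has an
independent set of size `K`. -/
theorem exists_independent_of_outdegree_le {ι : Type*} [DecidableEq ι] (R : ι → ι → Prop)
    [DecidableRel R] (d : ℕ) (K : ℕ) : ∀ V : Finset ι,
    (∀ j ∈ V, (V.filter fun i => R j i).card ≤ d) → (2 * d + 1) * K ≤ V.card →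
      ∃ J ⊆ V, J.card = K ∧ ∀ i ∈ J, ∀ j ∈ J, i ≠ j → ¬ R j i := by
  induction K with
  | zero => exact fun V _ _ => ⟨∅, by simp, by simp, by simp⟩
  | succ K ih =>
    intro V hV hcard
    have hVne : V.Nonempty := by
      rw [← Finset.card_pos]
      calc 0 < (2 * d + 1) * (K + 1) := by positivity
        _ ≤ _ := hcard
    -- The average in-degree equals the average out-degree, so some vertex has in-degree at most
    -- `d`. Removing it with its in- and out-neighbours costs at most `2 * d + 1` vertices.
    obtain ⟨x, hxV, hx⟩ : ∃ x ∈ V, (V.filter fun j => R j x).card ≤ d := by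
      by_contra! hcon
      have h1 : ∑ i ∈ V, (V.filter fun j => R j i).card = ∑ j ∈ V, (V.filter fun i => R j i).card :=
        (Finset.sum_card_bipartiteAbove_eq_sum_card_bipartiteBelow R).symm
      have h2 : ∑ i ∈ V, d < ∑ i ∈ V, (V.filter fun j => R j i).card :=
        Finset.sum_lt_sum_of_nonempty hVne hcon
      have h3 : ∑ j ∈ V, (V.filter fun i => R j i).card ≤ ∑ j ∈ V, d := Finset.sum_le_sum hV
      omega
    set D := insert x ((V.filter fun j => R j x) ∪ V.filter fun i => R x i) with hD
    have hDcard : D.card ≤ 2 * d + 1 := by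
      have h1 := Finset.card_insert_le x ((V.filter fun j => R j x) ∪ V.filter fun i => R x i)
      have h2 := Finset.card_union_le (V.filter fun j => R j x) (V.filter fun i => R x i)
      have h3 := hV x hxV
      rw [← hD] at h1
      omega
    obtain ⟨J, hJV, hJc, hJ⟩ := ih (V \ D)
      (fun j hj => (Finset.card_le_card (Finset.filter_subset_filter _ Finset.sdiff_subset)).trans
        (hV j (Finset.sdiff_subset hj)))
      (by
        have := Finset.le_card_sdiff D V
        have h4 : (2 * d + 1) * (K + 1) = (2 * d + 1) * K + (2 * d + 1) := by ring
        omega)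
    have hJD : ∀ y ∈ J, y ∈ V ∧ y ≠ x ∧ ¬ R y x ∧ ¬ R x y := fun y hy => by
      have h := Finset.mem_sdiff.1 (hJV hy)
      have h2 := h.2
      simp only [hD, Finset.mem_insert, Finset.mem_union, Finset.mem_filter, h.1, true_and,
        not_or] at h2
      exact ⟨h.1, h2⟩
    refine ⟨insert x J, ?_, ?_, ?_⟩
    · exact Finset.insert_subset hxV fun y hy => (hJD y hy).1
    · rw [Finset.card_insert_of_notMem fun h => (hJD x h).2.1 rfl, hJc]
    · intro i hi j hj hij
      rcases Finset.mem_insert.1 hi with hi' | hi' <;>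
        rcases Finset.mem_insert.1 hj with hj' | hj'
      · exact absurd (hi'.trans hj'.symm) hij
      · exact hi' ▸ (hJD j hj').2.2.1
      · exact hj' ▸ (hJD i hi').2.2.2
      · exact hJ i hi' j hj' hij

end Combinatorics

/-! ### The Boolean algebra of definable sets. -/

section DefinableSets

variable {N : Type w} [L.Structure N] {n m : ℕ}

theorem mem_definedBy {φ : L.Formula (Fin n ⊕ Fin m)} {b : Fin m → N} {x : Fin n → N} :
    x ∈ definedBy φ b ↔ φ.Realize (Sum.elim x b) :=
  Iff.rfl

/-- Every definable set is defined by a formula with finitely many parameters. -/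
theorem exists_eq_definedBy (X : L.DefinableSet (Set.univ : Set N) (Fin n)) :
    ∃ (m : ℕ) (φ : L.Formula (Fin n ⊕ Fin m)) (b : Fin m → N), X = definedBy φ b := by
  obtain ⟨A, -, hA⟩ := Set.definable_iff_finitely_definable.1 X.2
  obtain ⟨φ, hφ⟩ := Set.definable_iff_exists_formula_sum.1 hA
  refine ⟨A.card, φ.relabel (Sum.elim (fun a => Sum.inr (A.equivFin a)) Sum.inl),
    fun i => A.equivFin.symm i, SetLike.ext fun x => ?_⟩
  have h1 : x ∈ X ↔ φ.Realize (Sum.elim (fun a : (A : Set N) => (a : N)) x) :=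
    iff_of_eq (congrArg (x ∈ ·) hφ)
  rw [h1, mem_definedBy, Formula.realize_relabel]
  refine iff_of_eq (congrArg _ ?_)
  funext i
  rcases i with a | i
  · simp only [Function.comp_apply, Sum.elim_inl, Sum.elim_inr]
    exact congrArg Subtype.val (A.equivFin.symm_apply_apply a).symm
  · rfl

theorem mem_finset_sup {ι : Type*} {s : Finset ι}
    {f : ι → L.DefinableSet (Set.univ : Set N) (Fin n)} {x : Fin n → N} :
    x ∈ s.sup f ↔ ∃ i ∈ s, x ∈ f i := by
  classical
  induction s using Finset.induction_on with
  | empty => simp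
  | insert i s _ ih => simp [Finset.sup_insert, ih]

theorem mem_finset_inf {ι : Type*} {s : Finset ι}
    {f : ι → L.DefinableSet (Set.univ : Set N) (Fin n)} {x : Fin n → N} :
    x ∈ s.inf f ↔ ∀ i ∈ s, x ∈ f i := by
  classical
  induction s using Finset.induction_on with
  | empty => simp
  | insert i s _ ih => simp [Finset.inf_insert, ih]

theorem disjoint_of_forall {X Y : L.DefinableSet (Set.univ : Set N) (Fin n)}
    (h : ∀ x ∈ X, x ∉ Y) : Disjoint X Y := by
  rw [disjoint_iff]
  refine SetLike.ext fun x => ⟨fun hx => ?_, fun hx => (DefinableSet.notMem_bot hx).elim⟩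
  have := DefinableSet.mem_inf.1 hx
  exact (h x this.1 this.2).elim

theorem notMem_of_disjoint {X Y : L.DefinableSet (Set.univ : Set N) (Fin n)}
    (h : Disjoint X Y) {x : Fin n → N} (hx : x ∈ X) : x ∉ Y := fun hy => by
  have h2 : x ∈ X ⊓ Y := DefinableSet.mem_inf.2 ⟨hx, hy⟩
  rw [disjoint_iff.1 h] at h2
  exact DefinableSet.notMem_bot h2

end DefinableSets

/-! ### Basic properties of Keisler measures, and their replacement by weighted points on finite
algebras. -/

namespace KeislerMeasure

variable {N : Type w} [L.Structure N] {n m : ℕ} (μ : KeislerMeasure L N n)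

theorem mono {X Y : L.DefinableSet (Set.univ : Set N) (Fin n)} (h : X ≤ Y) :
    μ.toFun X ≤ μ.toFun Y := by
  have h1 : X ⊔ (Y \ X) = Y := sup_sdiff_cancel_right h
  rw [← h1, μ.map_sup _ _ disjoint_sdiff_self_right]
  linarith [μ.nonneg (Y \ X)]

theorem le_one (X : L.DefinableSet (Set.univ : Set N) (Fin n)) : μ.toFun X ≤ 1 :=
  μ.map_top ▸ μ.mono le_top

theorem map_bot : μ.toFun ⊥ = 0 := by
  have := μ.map_sup ⊥ ⊥ disjoint_bot_left
  rw [sup_bot_eq] at this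
  linarith

theorem map_finset_sup {ι : Type*} (s : Finset ι)
    (f : ι → L.DefinableSet (Set.univ : Set N) (Fin n))
    (h : ∀ i ∈ s, ∀ j ∈ s, i ≠ j → Disjoint (f i) (f j)) :
    μ.toFun (s.sup f) = ∑ i ∈ s, μ.toFun (f i) := by
  classical
  induction s using Finset.induction_on with
  | empty => simp [map_bot]
  | insert i s hi ih =>
    rw [Finset.sup_insert, Finset.sum_insert hi, μ.map_sup, ih]
    · exact fun j hj l hl => h j (Finset.mem_insert_of_mem hj) l (Finset.mem_insert_of_mem hl)
    · refine Finset.disjoint_sup_right.2 fun j hj => h i (Finset.mem_insert_self _ _) j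
        (Finset.mem_insert_of_mem hj) ?_
      rintro rfl
      exact hi hj

open Classical in
/-- The finitely supported Keisler measure with weights `p` at the points `q`. -/
noncomputable def pointMass {Ω : Type*} (P : Finset Ω) (q : Ω → Fin n → N) (p : Ω → ℝ)
    (hp : ∀ σ ∈ P, 0 ≤ p σ) (hp1 : ∑ σ ∈ P, p σ = 1) : KeislerMeasure L N n where
  toFun X := ∑ σ ∈ P with q σ ∈ X, p σ
  nonneg X := Finset.sum_nonneg fun σ hσ => hp σ (Finset.filter_subset _ _ hσ)
  map_top := by
    rw [← hp1]
    congr 1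
    exact Finset.filter_true_of_mem fun _ _ => DefinableSet.mem_top
  map_sup X Y h := by
    rw [← Finset.sum_union]
    · congr 1
      ext σ
      simp only [Finset.mem_union, Finset.mem_filter, DefinableSet.mem_sup]
      tauto
    · exact Finset.disjoint_filter.2 fun σ _ h1 => notMem_of_disjoint h h1

/-- The average of finitely many Keisler measures. -/
noncomputable def average {ι : Type*} (J : Finset ι) (hJ : J.Nonempty)
    (ρ : ι → KeislerMeasure L N n) : KeislerMeasure L N n where
  toFun X := (∑ j ∈ J, (ρ j).toFun X) / J.card
  nonneg X := div_nonneg (Finset.sum_nonneg fun j _ => (ρ j).nonneg X) (Nat.cast_nonneg _)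
  map_top := by
    have : (J.card : ℝ) ≠ 0 := by exact_mod_cast hJ.card_pos.ne'
    simp only [map_top, Finset.sum_const, nsmul_eq_mul, mul_one]
    exact div_self this
  map_sup X Y h := by
    simp only [fun j => (ρ j).map_sup X Y h, Finset.sum_add_distrib, add_div]

section Atoms

open Classical in
/-- The atom of the Boolean algebra generated by `F` consisting of the points that belong to
exactly the members `σ` of `F`. -/
noncomputable def atom (F σ : Finset (L.DefinableSet (Set.univ : Set N) (Fin n))) :
    L.DefinableSet (Set.univ : Set N) (Fin n) :=
  σ.inf id ⊓ (F \ σ).inf compl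

open Classical in
theorem mem_atom {F σ : Finset (L.DefinableSet (Set.univ : Set N) (Fin n))} (h : σ ⊆ F)
    {x : Fin n → N} : x ∈ atom F σ ↔ F.filter (x ∈ ·) = σ := by
  rw [atom, DefinableSet.mem_inf, mem_finset_inf, mem_finset_inf]
  constructor
  · rintro ⟨h1, h2⟩
    ext X
    rw [Finset.mem_filter]
    refine ⟨fun hX => ?_, fun hX => ⟨h hX, h1 X hX⟩⟩
    by_contra hσ
    exact DefinableSet.mem_compl.1 (h2 X (Finset.mem_sdiff.2 ⟨hX.1, hσ⟩)) hX.2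
  · rintro rfl
    refine ⟨fun X hX => (Finset.mem_filter.1 hX).2, fun X hX => ?_⟩
    rw [Finset.mem_sdiff, Finset.mem_filter] at hX
    exact DefinableSet.mem_compl.2 fun hx => hX.2 ⟨hX.1, hx⟩

theorem disjoint_atom {F σ τ : Finset (L.DefinableSet (Set.univ : Set N) (Fin n))} (hσ : σ ⊆ F)
    (hτ : τ ⊆ F) (h : σ ≠ τ) : Disjoint (atom F σ) (atom F τ) := by
  classical
  refine disjoint_of_forall fun x hx hx' => h ?_
  rw [mem_atom hσ] at hx
  rw [mem_atom hτ] at hx'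
  exact hx.symm.trans hx'

theorem map_sup_atom {F : Finset (L.DefinableSet (Set.univ : Set N) (Fin n))}
    {s : Finset (Finset (L.DefinableSet (Set.univ : Set N) (Fin n)))} (hs : s ⊆ F.powerset) :
    μ.toFun (s.sup (atom F)) = ∑ σ ∈ s, μ.toFun (atom F σ) :=
  μ.map_finset_sup s _ fun _ hσ _ hτ h => disjoint_atom (Finset.mem_powerset.1 (hs hσ))
    (Finset.mem_powerset.1 (hs hτ)) h

theorem sum_atom (F : Finset (L.DefinableSet (Set.univ : Set N) (Fin n))) :
    ∑ σ ∈ F.powerset, μ.toFun (atom F σ) = 1 := by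
  classical
  rw [← μ.map_sup_atom subset_rfl, ← μ.map_top]
  congr 1
  refine SetLike.ext fun x => ⟨fun _ => DefinableSet.mem_top, fun _ => ?_⟩
  rw [mem_finset_sup]
  exact ⟨F.filter (x ∈ ·), Finset.mem_powerset.2 (Finset.filter_subset _ _),
    (mem_atom (Finset.filter_subset _ _)).2 rfl⟩

open Classical in
/-- A Keisler measure agrees on a finite family with a measure concentrated on finitely many points,
which can be chosen to charge a given set `D` as much as its hull in the algebra generated by the
family. -/
theorem exists_points [Nonempty N] (F : Finset (L.DefinableSet (Set.univ : Set N) (Fin n)))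
    (D : L.DefinableSet (Set.univ : Set N) (Fin n)) :
    ∃ q : Finset (L.DefinableSet (Set.univ : Set N) (Fin n)) → Fin n → N,
      (∀ X ∈ F, ∑ σ ∈ F.powerset with q σ ∈ X, μ.toFun (atom F σ) = μ.toFun X) ∧
      ∃ s ⊆ F.powerset, D ≤ s.sup (atom F) ∧
        μ.toFun (s.sup (atom F)) ≤ ∑ σ ∈ F.powerset with q σ ∈ D, μ.toFun (atom F σ) := by
  have hq : ∀ σ, ∃ x : Fin n → N, ((∃ y, y ∈ atom F σ) → x ∈ atom F σ) ∧
      ((∃ y, y ∈ atom F σ ⊓ D) → x ∈ D) := by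
    intro σ
    by_cases h1 : ∃ y, y ∈ atom F σ ⊓ D
    · obtain ⟨y, hy⟩ := h1
      exact ⟨y, fun _ => (DefinableSet.mem_inf.1 hy).1, fun _ => (DefinableSet.mem_inf.1 hy).2⟩
    · by_cases h2 : ∃ y, y ∈ atom F σ
      · exact ⟨h2.choose, fun _ => h2.choose_spec, fun h => (h1 h).elim⟩
      -- The atom is empty and has weight 0, so the position of its point is irrelevant.
      · exact ⟨fun _ => Classical.arbitrary N, fun h => (h2 h).elim, fun h => (h1 h).elim⟩
  choose q hq1 hq2 using hq
  refine ⟨q, fun X hX => ?_, F.powerset.filter fun σ => ∃ y, y ∈ atom F σ ⊓ D,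
    Finset.filter_subset _ _, fun x hx => ?_, ?_⟩
  · have h1 : X = (F.powerset.filter (X ∈ ·)).sup (atom F) := by
      refine SetLike.ext fun x => ?_
      rw [mem_finset_sup]
      constructor
      · exact fun hx => ⟨F.filter (x ∈ ·), Finset.mem_filter.2 ⟨Finset.mem_powerset.2
          (Finset.filter_subset _ _), Finset.mem_filter.2 ⟨hX, hx⟩⟩,
          (mem_atom (Finset.filter_subset _ _)).2 rfl⟩
      · rintro ⟨σ, hσ, hx⟩
        rw [Finset.mem_filter, Finset.mem_powerset] at hσ
        rw [mem_atom hσ.1] at hx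
        rw [← hx, Finset.mem_filter] at hσ
        exact hσ.2.2
    conv_rhs => rw [h1, μ.map_sup_atom (Finset.filter_subset _ _)]
    rw [Finset.sum_filter, Finset.sum_filter]
    refine Finset.sum_congr rfl fun σ hσ => ?_
    by_cases hne : ∃ y, y ∈ atom F σ
    · have h2 := (mem_atom (Finset.mem_powerset.1 hσ)).1 (hq1 σ hne)
      have h3 : q σ ∈ X ↔ X ∈ σ := by
        conv_rhs => rw [← h2, Finset.mem_filter]
        exact ⟨fun h => ⟨hX, h⟩, fun h => h.2⟩
      simp only [h3]
    · have h2 : atom F σ = ⊥ := SetLike.ext fun x =>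
        ⟨fun hx => (hne ⟨x, hx⟩).elim, fun hx => (DefinableSet.notMem_bot hx).elim⟩
      simp [h2, map_bot]
  · refine mem_finset_sup.2 ⟨F.filter (x ∈ ·), ?_, (mem_atom (Finset.filter_subset _ _)).2 rfl⟩
    exact Finset.mem_filter.2 ⟨Finset.mem_powerset.2 (Finset.filter_subset _ _), x,
      DefinableSet.mem_inf.2 ⟨(mem_atom (Finset.filter_subset _ _)).2 rfl, hx⟩⟩
  · rw [μ.map_sup_atom (Finset.filter_subset _ _)]
    refine Finset.sum_le_sum_of_subset_of_nonneg (fun σ hσ => ?_) fun _ _ _ => μ.nonneg _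
    rw [Finset.mem_filter] at hσ ⊢
    exact ⟨hσ.1, hq2 σ hσ.2⟩

end Atoms

end KeislerMeasure

/-! ### Sparse families and measures that spread mass over them. -/

section Sparse

variable {N : Type w} [L.Structure N] {n m : ℕ}

open Classical in
/-- Every point satisfies fewer than `k` of the formulas `φ(x, b 0), …, φ(x, b (K - 1))`. -/
def Sparse (φ : L.Formula (Fin n ⊕ Fin m)) (k K : ℕ) (b : ℕ → Fin m → N) : Prop :=
  ∀ x : Fin n → N, ((Finset.range K).filter fun j => x ∈ definedBy φ (b j)).card < k

theorem Sparse.comp {φ : L.Formula (Fin n ⊕ Fin m)} {k K K' : ℕ} {b : ℕ → Fin m → N}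
    (h : Sparse φ k K b) (e : ℕ → ℕ) (he : ∀ j < K', e j < K)
    (hinj : ∀ i < K', ∀ j < K', e i = e j → i = j) : Sparse φ k K' fun j => b (e j) := by
  classical
  intro x
  refine lt_of_le_of_lt ?_ (h x)
  refine Finset.card_le_card_of_injOn e (fun j hj => ?_) fun i hi j hj hij => ?_
  · have hj := Finset.mem_filter.1 hj
    exact Finset.mem_filter.2 ⟨Finset.mem_range.2 (he j (Finset.mem_range.1 hj.1)), hj.2⟩
  · exact hinj i (Finset.mem_range.1 (Finset.mem_filter.1 hi).1) j
      (Finset.mem_range.1 (Finset.mem_filter.1 hj).1) hij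

/-- There are arbitrarily long `k`-inconsistent families of instances of `φ` none of which is
contained in one of finitely many given definable sets of measure less than `ε`. -/
def HasLargeSparse (μ : KeislerMeasure L N n) (φ : L.Formula (Fin n ⊕ Fin m)) (k : ℕ) (ε : ℝ) :
    Prop :=
  ∀ (K : ℕ) (F : Finset (L.DefinableSet (Set.univ : Set N) (Fin n))), (∀ X ∈ F, μ.toFun X < ε) →
    ∃ b : ℕ → Fin m → N, Sparse φ k K b ∧ ∀ j < K, ∀ X ∈ F, ¬ definedBy φ (b j) ≤ X

/-- Double counting: each point lies in fewer than `k` of the instances. -/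
theorem Sparse.sum_pointMass_le {φ : L.Formula (Fin n ⊕ Fin m)} {k K : ℕ} {b : ℕ → Fin m → N}
    (h : Sparse φ k K b) {Ω : Type*} (P : Finset Ω) (q : Ω → Fin n → N) (p : Ω → ℝ)
    (hp : ∀ σ ∈ P, 0 ≤ p σ) (hp1 : ∑ σ ∈ P, p σ = 1) :
    ∑ j ∈ Finset.range K, (KeislerMeasure.pointMass P q p hp hp1).toFun (definedBy φ (b j)) ≤ k := by
  classical
  simp only [KeislerMeasure.pointMass, Finset.sum_filter]
  rw [Finset.sum_comm]
  calc _ ≤ ∑ σ ∈ P, k * p σ := by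
        refine Finset.sum_le_sum fun σ hσ => ?_
        rw [← Finset.sum_filter, Finset.sum_const, nsmul_eq_mul]
        refine mul_le_mul_of_nonneg_right ?_ (hp σ hσ)
        exact_mod_cast (h (q σ)).le
    _ = k := by rw [← Finset.mul_sum, hp1, mul_one]

/-- An instance contained in no small set of the algebra generated by `F` has a hull of measure at
least `ε`. Moving the mass of each atom to a point of the instance, where possible, gives the
instance the mass of its hull without changing the measure on `F`. -/
theorem HasLargeSparse.exists_sparse_pointMass [Nonempty N] {μ : KeislerMeasure L N n}
    {φ : L.Formula (Fin n ⊕ Fin m)} {k : ℕ} {ε : ℝ} (h : HasLargeSparse μ φ k ε) (K : ℕ)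
    (F : Finset (L.DefinableSet (Set.univ : Set N) (Fin n))) :
    ∃ (b : ℕ → Fin m → N) (ρ : ℕ → KeislerMeasure L N n), Sparse φ k K b ∧
      (∀ j, ∀ X ∈ F, (ρ j).toFun X = μ.toFun X) ∧
      (∀ j < K, ε ≤ (ρ j).toFun (definedBy φ (b j))) ∧
      ∀ j, ∑ i ∈ Finset.range K, (ρ j).toFun (definedBy φ (b i)) ≤ k := by
  classical
  -- The sets to be avoided are all unions of atoms of measure below `ε`; the hull of each of the
  -- `K` instances is a union of atoms, and so is not among them.
  obtain ⟨b, hb, hbF⟩ := h K ((F.powerset.powerset.image fun s => s.sup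
    (KeislerMeasure.atom F)).filter fun X => μ.toFun X < ε)
    fun X hX => (Finset.mem_filter.1 hX).2
  choose q hq s hs hD hsD using fun j => μ.exists_points F (definedBy φ (b j))
  refine ⟨b, fun j => KeislerMeasure.pointMass F.powerset (q j)
    (fun σ => μ.toFun (KeislerMeasure.atom F σ)) (fun _ _ => μ.nonneg _) (μ.sum_atom F), hb,
    fun j X hX => ?_, fun j hj => ?_, fun j => hb.sum_pointMass_le _ _ _ _ _⟩
  · exact hq j X hX
  · refine le_trans ?_ (hsD j)
    by_contra! hlt
    exact hbF j hj _ (Finset.mem_filter.2 ⟨Finset.mem_image.2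
      ⟨s j, Finset.mem_powerset.2 (hs j), rfl⟩, hlt⟩) (hD j)

/-- Join `j` to `i` when `ρ j` gives the `i`-th instance more than `δ`. By sparseness out-degrees
are at most `k / δ`, so there is an independent set of `K` instances. In the average of their
measures each instance keeps mass at least `ε / K`, but only one of the `K` summands charges it by
more than `δ`. -/
theorem HasLargeSparse.exists_spread [Nonempty N] {μ : KeislerMeasure L N n}
    {φ : L.Formula (Fin n ⊕ Fin m)} {k : ℕ} {ε : ℝ} (h : HasLargeSparse μ φ k ε) {K : ℕ}
    (hK : 0 < K) {δ : ℝ} (hδ : 0 < δ) (F : Finset (L.DefinableSet (Set.univ : Set N) (Fin n))) :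
    ∃ (b : ℕ → Fin m → N) (ρ : KeislerMeasure L N n), Sparse φ k K b ∧
      (∀ X ∈ F, ρ.toFun X = μ.toFun X) ∧
      ε ≤ ∑ j ∈ Finset.range K, ρ.toFun (definedBy φ (b j)) ∧
      ∀ j < K, ∀ X ∈ F, ρ.toFun (definedBy φ (b j) ⊓ X) ≤ μ.toFun X / K + δ := by
  classical
  obtain ⟨d, hd⟩ := exists_nat_ge ((k : ℝ) / δ)
  obtain ⟨b, ρ, hb, hρF, hρε, hρk⟩ := h.exists_sparse_pointMass ((2 * d + 1) * K) F
  obtain ⟨J, hJV, hJc, hJ⟩ := exists_independent_of_outdegree_le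
    (fun j i => δ < (ρ j).toFun (definedBy φ (b i))) d K (Finset.range ((2 * d + 1) * K))
    (fun j _ => by
      have h1 : ∑ i ∈ (Finset.range ((2 * d + 1) * K)).filter
          (fun i => δ < (ρ j).toFun (definedBy φ (b i))), δ ≤ k := by
        refine le_trans ?_ (hρk j)
        refine (Finset.sum_le_sum fun i hi => (Finset.mem_filter.1 hi).2.le).trans
          (Finset.sum_le_sum_of_subset_of_nonneg (Finset.filter_subset _ _)
            fun _ _ _ => (ρ j).nonneg _)
      rw [Finset.sum_const, nsmul_eq_mul, ← le_div_iff₀ hδ] at h1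
      exact_mod_cast h1.trans hd)
    (by rw [Finset.card_range])
  have hJne : J.Nonempty := Finset.card_pos.1 (hJc ▸ hK)
  have hKR : (0 : ℝ) < K := by exact_mod_cast hK
  let e : ℕ → ℕ := fun i => if hi : i < K then J.orderEmbOfFin hJc ⟨i, hi⟩ else 0
  have heJ : ∀ i < K, e i ∈ J := fun i hi => by
    simp only [e, dif_pos hi]
    exact J.orderEmbOfFin_mem hJc _
  have heinj : ∀ i < K, ∀ j < K, e i = e j → i = j := fun i hi j hj hij => by
    simp only [e, dif_pos hi, dif_pos hj] at hij
    exact congrArg Fin.val ((J.orderEmbOfFin hJc).injective hij)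
  have heimg : (Finset.range K).image e = J := by
    refine Finset.eq_of_subset_of_card_le (fun y hy => ?_) ?_
    · obtain ⟨i, hi, rfl⟩ := Finset.mem_image.1 hy
      exact heJ i (Finset.mem_range.1 hi)
    · rw [Finset.card_image_of_injOn, Finset.card_range, hJc]
      exact fun i hi j hj => heinj i (by simpa using hi) j (by simpa using hj)
  refine ⟨fun i => b (e i), KeislerMeasure.average J hJne ρ,
    hb.comp e (fun i hi => Finset.mem_range.1 (hJV (heJ i hi))) heinj, fun X hX => ?_, ?_,
    fun i hi X hX => ?_⟩
  · simp only [KeislerMeasure.average, hρF _ X hX, Finset.sum_const, nsmul_eq_mul, hJc]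
    field_simp
  · rw [← Finset.sum_image (s := Finset.range K) (g := e)
      (f := fun i => (KeislerMeasure.average J hJne ρ).toFun (definedBy φ (b i)))
      (fun i hi j hj => heinj i (by simpa using hi) j (by simpa using hj)), heimg]
    have h1 : ∀ i ∈ J, ε / K ≤ (KeislerMeasure.average J hJne ρ).toFun (definedBy φ (b i)) := by
      intro i hi
      simp only [KeislerMeasure.average, hJc]
      refine div_le_div_of_nonneg_right ?_ hKR.le
      exact (hρε i (Finset.mem_range.1 (hJV hi))).trans
        (Finset.single_le_sum (f := fun j => (ρ j).toFun (definedBy φ (b i)))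
          (fun j _ => (ρ j).nonneg _) hi)
    refine le_trans ?_ (Finset.sum_le_sum h1)
    rw [Finset.sum_const, hJc, nsmul_eq_mul]
    field_simp
    exact le_rfl
  · have h1 : ∀ j ∈ J, (ρ j).toFun (definedBy φ (b (e i)) ⊓ X) ≤
        (if j = e i then μ.toFun X else 0) + δ := by
      intro j hj
      split_ifs with hji
      · have := (ρ j).mono (inf_le_right : definedBy φ (b (e i)) ⊓ X ≤ X)
        rw [hρF j X hX] at this
        linarith
      · rw [zero_add]
        exact ((ρ j).mono inf_le_left).trans
          (not_lt.1 (hJ (e i) (heJ i hi) j hj fun h => hji h.symm))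
    simp only [KeislerMeasure.average, hJc]
    rw [div_le_iff₀ hKR]
    refine (Finset.sum_le_sum h1).trans (le_of_eq ?_)
    rw [Finset.sum_add_distrib, Finset.sum_const, hJc, Finset.sum_ite_eq' J (e i), if_pos (heJ i hi),
      nsmul_eq_mul]
    field_simp

end Sparse

/-! ### Ultraproducts of Keisler measures. -/

section Ultraproducts

open Filter Topology

variable {I : Type w'} {U : Ultrafilter I} {N : I → Type w} [∀ i, L.Structure (N i)] {n m : ℕ}

/-- The class in the ultraproduct of a tuple of sequences. -/
def ultraTuple {α : Type*} (U : Ultrafilter I) (x : α → ∀ i, N i) : α → (U : Filter I).Product N :=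
  fun l => (x l : (U : Filter I).Product N)

theorem exists_ultraTuple_eq {α : Type*} (y : α → (U : Filter I).Product N) :
    ∃ x : α → ∀ i, N i, ultraTuple U x = y := by
  have : ∀ l, ∃ z : ∀ i, N i, (z : (U : Filter I).Product N) = y l := fun l =>
    Quotient.exists_rep (y l)
  choose x hx using this
  exact ⟨x, funext hx⟩

/-- The diagonal embedding into an ultraproduct of elementary extensions. -/
def ultraEmbedding {M : Type*} [L.Structure M] [∀ i, Nonempty (N i)] (U : Ultrafilter I)
    (f : ∀ i, M ↪ₑ[L] N i) : M ↪ₑ[L] (U : Filter I).Product N where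
  toFun a := ((fun i => f i a : ∀ i, N i) : (U : Filter I).Product N)
  map_formula' r φ x := by
    have h := Ultraproduct.realize_formula_cast (u := U) φ (fun l i => f i (x l))
    refine h.trans ?_
    have h2 : ∀ i, φ.Realize (fun l => f i (x l)) ↔ φ.Realize x := fun i => (f i).map_formula φ x
    simp only [h2, eventually_const]

/-- The definable set `X` of the ultraproduct is the ultraproduct of the definable sets `Y i`. -/
def Represents (X : L.DefinableSet (Set.univ : Set ((U : Filter I).Product N)) (Fin n))
    (Y : ∀ i, L.DefinableSet (Set.univ : Set (N i)) (Fin n)) : Prop :=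
  ∀ x : Fin n → ∀ i, N i, ultraTuple U x ∈ X ↔ ∀ᶠ i in U, (fun l => x l i) ∈ Y i

theorem represents_definedBy [∀ i, Nonempty (N i)] (φ : L.Formula (Fin n ⊕ Fin m))
    (b : Fin m → ∀ i, N i) :
    Represents (definedBy φ (ultraTuple U b)) fun i => definedBy φ fun l => b l i := by
  intro x
  have h := Ultraproduct.realize_formula_cast (u := U) φ (Sum.elim x b)
  have h1 : (fun l => ((Sum.elim x b l : ∀ i, N i) : (U : Filter I).Product N)) =
      Sum.elim (ultraTuple U x) (ultraTuple U b) := by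
    funext l
    rcases l with l | l <;> rfl
  have h2 : ∀ i, (fun l => Sum.elim x b l i) = Sum.elim (fun l => x l i) fun l => b l i := by
    intro i
    funext l
    rcases l with l | l <;> rfl
  simp only [h1, h2] at h
  exact h

theorem exists_represents [∀ i, Nonempty (N i)]
    (X : L.DefinableSet (Set.univ : Set ((U : Filter I).Product N)) (Fin n)) :
    ∃ Y, Represents X Y := by
  obtain ⟨m, φ, b, rfl⟩ := exists_eq_definedBy X
  obtain ⟨b, rfl⟩ := exists_ultraTuple_eq b
  exact ⟨_, represents_definedBy φ b⟩

variable {X X' : L.DefinableSet (Set.univ : Set ((U : Filter I).Product N)) (Fin n)}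
  {Y Y' : ∀ i, L.DefinableSet (Set.univ : Set (N i)) (Fin n)}

theorem Represents.eventually_le [∀ i, Nonempty (N i)] (h : Represents X Y)
    (h' : Represents X' Y') (hle : X ≤ X') : ∀ᶠ i in U, Y i ≤ Y' i := by
  classical
  by_contra hcon
  rw [← Ultrafilter.eventually_not] at hcon
  let x : ∀ i, Fin n → N i := fun i =>
    if hi : ∃ x : Fin n → N i, x ∈ Y i ∧ x ∉ Y' i then hi.choose
    else fun _ => Classical.arbitrary _
  have hx : ∀ᶠ i in U, x i ∈ Y i ∧ x i ∉ Y' i := by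
    filter_upwards [hcon] with i hi
    have hi : ∃ x : Fin n → N i, x ∈ Y i ∧ x ∉ Y' i := by
      by_contra! h3
      exact hi fun x hx => h3 x hx
    simp only [x, dif_pos hi]
    exact hi.choose_spec
  have h1 : ultraTuple U (fun l i => x i l) ∈ X := (h _).2 (hx.mono fun i hi => hi.1)
  have h2 := (h' _).1 (hle h1)
  obtain ⟨i, hi⟩ := (h2.and hx).exists
  exact hi.2.2 hi.1

theorem Represents.eventually_eq [∀ i, Nonempty (N i)] (h : Represents X Y)
    (h' : Represents X Y') : ∀ᶠ i in U, Y i = Y' i := by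
  filter_upwards [h.eventually_le h' le_rfl, h'.eventually_le h le_rfl] with i h1 h2
  exact le_antisymm h1 h2

theorem Represents.sup (h : Represents X Y) (h' : Represents X' Y') :
    Represents (X ⊔ X') fun i => Y i ⊔ Y' i := by
  intro x
  simp only [DefinableSet.mem_sup, Ultrafilter.eventually_or]
  exact or_congr (h x) (h' x)

theorem Represents.inf (h : Represents X Y) (h' : Represents X' Y') :
    Represents (X ⊓ X') fun i => Y i ⊓ Y' i := by
  intro x
  simp only [DefinableSet.mem_inf, Filter.eventually_and]
  exact and_congr (h x) (h' x)

theorem represents_top : Represents (⊤ : L.DefinableSet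
    (Set.univ : Set ((U : Filter I).Product N)) (Fin n)) fun _ => ⊤ := by
  intro x
  simp only [DefinableSet.mem_top, Filter.eventually_true]

theorem represents_bot : Represents (⊥ : L.DefinableSet
    (Set.univ : Set ((U : Filter I).Product N)) (Fin n)) fun _ => ⊥ := by
  intro x
  simp only [DefinableSet.notMem_bot, Filter.eventually_false_iff_eq_bot, false_iff]
  exact U.neBot.ne

theorem exists_tendsto_of_mem_Icc {f : I → ℝ} (hf : ∀ i, f i ∈ Set.Icc (0 : ℝ) 1) :
    ∃ a, Tendsto f U (𝓝 a) := by
  obtain ⟨a, -, ha⟩ := isCompact_Icc.ultrafilter_le_nhds (U.map f)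
    (le_principal_iff.2 (Filter.mem_map.2 (Filter.univ_mem' hf)))
  exact ⟨a, ha⟩

/-- Two sequences representing the same set agree almost everywhere, so the limit of the measures
depends only on the set. -/
theorem exists_ultralimit [∀ i, Nonempty (N i)] (U : Ultrafilter I)
    (ρ : ∀ i, KeislerMeasure L (N i) n) :
    ∃ τ : L.DefinableSet (Set.univ : Set ((U : Filter I).Product N)) (Fin n) → ℝ,
      ∀ X Y, Represents X Y → Tendsto (fun i => (ρ i).toFun (Y i)) U (𝓝 (τ X)) := by
  choose Z hZ using exists_represents (L := L) (U := U) (N := N) (n := n)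
  choose τ hτ using fun X => exists_tendsto_of_mem_Icc (U := U)
    (f := fun i => (ρ i).toFun (Z X i)) fun i => ⟨(ρ i).nonneg _, (ρ i).le_one _⟩
  refine ⟨τ, fun X Y h => (hτ X).congr' ?_⟩
  filter_upwards [(hZ X).eventually_eq h] with i hi
  rw [hi]

/-- The ultraproduct of Keisler measures. -/
noncomputable def ultraMeasure [∀ i, Nonempty (N i)] (U : Ultrafilter I)
    (ρ : ∀ i, KeislerMeasure L (N i) n) : KeislerMeasure L ((U : Filter I).Product N) n where
  toFun := (exists_ultralimit U ρ).choose
  nonneg := fun X => by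
    obtain ⟨Y, hY⟩ := exists_represents X
    exact ge_of_tendsto' ((exists_ultralimit U ρ).choose_spec X Y hY) fun i => (ρ i).nonneg _
  map_top := by
    refine tendsto_nhds_unique ((exists_ultralimit U ρ).choose_spec _ _ represents_top) ?_
    simp only [KeislerMeasure.map_top]
    exact tendsto_const_nhds
  map_sup := fun X X' hd => by
    obtain ⟨Y, hY⟩ := exists_represents X
    obtain ⟨Y', hY'⟩ := exists_represents X'
    refine tendsto_nhds_unique ((exists_ultralimit U ρ).choose_spec _ _ (hY.sup hY'))
      ((((exists_ultralimit U ρ).choose_spec _ _ hY).add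
        ((exists_ultralimit U ρ).choose_spec _ _ hY')).congr' ?_)
    filter_upwards [(hY.inf hY').eventually_le represents_bot (disjoint_iff_inf_le.1 hd)]
      with i hi
    exact ((ρ i).map_sup _ _ (disjoint_iff_inf_le.2 hi)).symm

theorem tendsto_ultraMeasure [∀ i, Nonempty (N i)] (ρ : ∀ i, KeislerMeasure L (N i) n)
    (h : Represents X Y) :
    Tendsto (fun i => (ρ i).toFun (Y i)) U (𝓝 ((ultraMeasure U ρ).toFun X)) :=
  (exists_ultralimit U ρ).choose_spec X Y h

end Ultraproducts

/-! ### Extensions of a Keisler measure over elementary extensions. -/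

section Extensions

open Filter Topology

variable {M : Type w} [L.Structure M] {n : ℕ}

/-- A Keisler measure over an elementary extension of `M` that extends `μ`. -/
structure MeasureExtension (μ : KeislerMeasure L M n) where
  /-- The elementary extension. -/
  N : Type (max u v w)
  /-- Its structure. -/
  [str : L.Structure N]
  /-- The elementary embedding. -/
  f : M ↪ₑ[L] N
  /-- The Keisler measure. -/
  ν : KeislerMeasure L N n
  ext : ν.Extends f μ

attribute [instance] MeasureExtension.str

theorem KeislerMeasure.Extends.trans {N : Type*} {P : Type*} [L.Structure N] [L.Structure P]
    {μ : KeislerMeasure L M n} {ν : KeislerMeasure L N n} {π : KeislerMeasure L P n}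
    {f : M ↪ₑ[L] N} {g : N ↪ₑ[L] P} (h' : π.Extends g ν) (h : ν.Extends f μ) :
    π.Extends (g.comp f) μ :=
  fun m φ b => (h' m φ (f ∘ b)).trans (h m φ b)

/-- Composition of extensions of Keisler measures. -/
def MeasureExtension.comp {μ : KeislerMeasure L M n} (E : MeasureExtension μ)
    (E' : MeasureExtension E.ν) : MeasureExtension μ where
  N := E'.N
  f := E'.f.comp E.f
  ν := E'.ν
  ext := E'.ext.trans E.ext

theorem MeasureExtension.nonempty [Nonempty M] {μ : KeislerMeasure L M n}
    (E : MeasureExtension μ) : Nonempty E.N :=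
  ‹Nonempty M›.map E.f

/-- The ultraproduct of measures over `M` that eventually agree with `μ` on each definable set. -/
noncomputable def MeasureExtension.ultrapower [Nonempty M] {I : Type (max u v w)}
    (U : Ultrafilter I) (μ : KeislerMeasure L M n) (ρ : I → KeislerMeasure L M n)
    (h : ∀ X, ∀ᶠ i in U, (ρ i).toFun X = μ.toFun X) :
    MeasureExtension μ where
  N := (U : Filter I).Product fun _ => M
  f := ultraEmbedding U fun _ => ElementaryEmbedding.refl L M
  ν := ultraMeasure U ρ
  ext m φ b := by
    refine tendsto_nhds_unique (tendsto_ultraMeasure ρ (represents_definedBy φ _))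
      (tendsto_const_nhds.congr' ?_)
    filter_upwards [h (definedBy φ b)] with i hi
    exact hi.symm

/-- The ultraproduct of extensions of `μ`. -/
noncomputable def MeasureExtension.ultraproduct [Nonempty M] {I : Type (max u v)}
    (U : Ultrafilter I) {μ : KeislerMeasure L M n} (E : I → MeasureExtension μ) :
    MeasureExtension μ :=
  have : ∀ i, Nonempty (E i).N := fun i => (E i).nonempty
  { N := (U : Filter I).Product fun i => (E i).N
    f := ultraEmbedding U fun i => (E i).f
    ν := ultraMeasure U fun i => (E i).ν
    ext := fun m φ b => by
      refine tendsto_nhds_unique (tendsto_ultraMeasure _ (represents_definedBy φ _))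
        (tendsto_const_nhds.congr fun i => ?_)
      exact ((E i).ext m φ b).symm }

end Extensions

/-! ### First-order expressions for intersection and inclusion of instances. -/

section Transfer

variable {M : Type w} {N : Type w'} [L.Structure M] [L.Structure N] {n m m' : ℕ}

/-- The conjunction of two formulas, with their parameters put side by side. -/
def infFormula (φ : L.Formula (Fin n ⊕ Fin m)) (ψ : L.Formula (Fin n ⊕ Fin m')) :
    L.Formula (Fin n ⊕ Fin (m + m')) :=
  φ.relabel (Sum.map id (Fin.castAdd m')) ⊓ ψ.relabel (Sum.map id (Fin.natAdd m))

theorem definedBy_infFormula (φ : L.Formula (Fin n ⊕ Fin m)) (ψ : L.Formula (Fin n ⊕ Fin m'))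
    (b : Fin m → M) (c : Fin m' → M) :
    definedBy (infFormula φ ψ) (Fin.append b c) = definedBy φ b ⊓ definedBy ψ c := by
  refine SetLike.ext fun x => ?_
  have h1 : Sum.elim x (Fin.append b c) ∘ Sum.map id (Fin.castAdd m') = Sum.elim x b := by
    funext i
    rcases i with i | i <;> simp
  have h2 : Sum.elim x (Fin.append b c) ∘ Sum.map id (Fin.natAdd m) = Sum.elim x c := by
    funext i
    rcases i with i | i <;> simp
  rw [DefinableSet.mem_inf, mem_definedBy, mem_definedBy, mem_definedBy, infFormula,
    Formula.realize_inf, Formula.realize_relabel, Formula.realize_relabel, h1, h2]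

/-- A finite intersection of instances is a single instance, uniformly in the two models, so that
statements about one formula over `M` apply to cells of an array. -/
theorem exists_inf_eq_definedBy {ι : Type*} (f : M ↪ₑ[L] N) (φ : L.Formula (Fin n ⊕ Fin m))
    (b : ι → Fin m → M) (S : Finset ι) :
    ∃ (m' : ℕ) (ψ : L.Formula (Fin n ⊕ Fin m')) (c : Fin m' → M),
      S.inf (fun i => definedBy φ (b i)) = definedBy ψ c ∧
      S.inf (fun i => definedBy φ (f ∘ b i)) = definedBy ψ (f ∘ c) := by
  classical
  induction S using Finset.induction_on with
  | empty =>
    refine ⟨0, ⊤, Fin.elim0, ?_, ?_⟩ <;>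
    · rw [Finset.inf_empty]
      exact SetLike.ext fun x => ⟨fun _ => Formula.realize_top.2 trivial,
        fun _ => DefinableSet.mem_top⟩
  | insert i S _ ih =>
    obtain ⟨m', ψ, c, h1, h2⟩ := ih
    refine ⟨m + m', infFormula φ ψ, Fin.append (b i) c, ?_, ?_⟩
    · rw [Finset.inf_insert, h1, definedBy_infFormula]
    · have h3 : f ∘ Fin.append (b i) c = Fin.append (f ∘ b i) (f ∘ c) := by
        funext j
        refine Fin.addCases (fun j => ?_) (fun j => ?_) j <;> simp
      rw [Finset.inf_insert, h2, h3, definedBy_infFormula]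

/-- The formula saying that the instance of `φ` is contained in the instance of `ψ`. -/
noncomputable def leFormula (φ : L.Formula (Fin n ⊕ Fin m)) (ψ : L.Formula (Fin n ⊕ Fin m')) :
    L.Formula (Fin m ⊕ Fin m') :=
  ((φ.relabel (Sum.elim Sum.inr (Sum.inl ∘ Sum.inl))).imp
    (ψ.relabel (Sum.elim Sum.inr (Sum.inl ∘ Sum.inr)))).iAlls (Fin n)

theorem realize_leFormula {φ : L.Formula (Fin n ⊕ Fin m)} {ψ : L.Formula (Fin n ⊕ Fin m')}
    {v : Fin m ⊕ Fin m' → M} :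
    (leFormula φ ψ).Realize v ↔ definedBy φ (v ∘ Sum.inl) ≤ definedBy ψ (v ∘ Sum.inr) := by
  rw [leFormula, Formula.realize_iAlls]
  refine forall_congr' fun x => ?_
  have h1 : Sum.elim v x ∘ Sum.elim Sum.inr (Sum.inl ∘ Sum.inl) = Sum.elim x (v ∘ Sum.inl) := by
    funext i
    rcases i with i | i <;> rfl
  have h2 : Sum.elim v x ∘ Sum.elim Sum.inr (Sum.inl ∘ Sum.inr) = Sum.elim x (v ∘ Sum.inr) := by
    funext i
    rcases i with i | i <;> rfl
  rw [Formula.realize_imp, Formula.realize_relabel, Formula.realize_relabel, h1, h2]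
  rfl

end Transfer

/-! ### Sparseness in ultraproducts and elementary extensions. -/

section Sparse

open Filter

theorem sparse_ultraTuple {I : Type w'} {U : Ultrafilter I} {N : I → Type w}
    [∀ i, L.Structure (N i)] [∀ i, Nonempty (N i)] {n m : ℕ} {φ : L.Formula (Fin n ⊕ Fin m)}
    {k K : ℕ} {b : ℕ → Fin m → ∀ i, N i} (h : ∀ᶠ i in U, Sparse φ k K fun j l => b j l i) :
    Sparse φ k K fun j => ultraTuple U (b j) := by
  classical
  intro y
  obtain ⟨x, rfl⟩ := exists_ultraTuple_eq y
  have h1 : ∀ᶠ i in U, ∀ j ∈ Finset.range K, ultraTuple U x ∈ definedBy φ (ultraTuple U (b j)) →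
      (fun l => x l i) ∈ definedBy φ fun l => b j l i := by
    refine (Filter.eventually_all_finset _).2 fun j _ => ?_
    by_cases hj : ultraTuple U x ∈ definedBy φ (ultraTuple U (b j))
    · exact ((represents_definedBy φ (b j) x).1 hj).mono fun i hi _ => hi
    · exact Eventually.of_forall fun i hi => (hj hi).elim
  obtain ⟨i, hi, hi'⟩ := (h.and h1).exists
  refine lt_of_le_of_lt (Finset.card_le_card fun j hj => ?_) (hi fun l => x l i)
  rw [Finset.mem_filter] at hj ⊢
  exact ⟨hj.1, hi' j hj.1 hj.2⟩

theorem Sparse.map {M : Type w} {N : Type w'} [L.Structure M] [L.Structure N] {n m : ℕ}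
    {φ : L.Formula (Fin n ⊕ Fin m)} {k K : ℕ} {b : ℕ → Fin m → M} (h : Sparse φ k K b)
    (f : M ↪ₑ[L] N) : Sparse φ k K fun j => f ∘ b j := by
  classical
  intro y
  by_contra! hy
  set S := (Finset.range K).filter fun j => y ∈ definedBy φ (f ∘ b j) with hS
  obtain ⟨m', ψ, c, h1, h2⟩ := exists_inf_eq_definedBy f φ b S
  have hyS : y ∈ definedBy ψ (f ∘ c) := by
    rw [← h2, mem_finset_inf]
    exact fun j hj => (Finset.mem_filter.1 hj).2
  have hne : ¬ definedBy ψ c ≤ definedBy (⊥ : L.Formula (Fin n ⊕ Fin 0)) Fin.elim0 := by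
    intro hle
    have h3 := (realize_leFormula (v := Sum.elim c Fin.elim0)).2 hle
    rw [← f.map_formula, Sum.comp_elim] at h3
    exact (realize_leFormula.1 h3) hyS
  obtain ⟨x, hx⟩ : ∃ x, x ∈ definedBy ψ c := by
    by_contra! hcon
    exact hne fun x hx => (hcon x hx).elim
  rw [← h1, mem_finset_inf] at hx
  refine (lt_of_le_of_lt hy (lt_of_le_of_lt (Finset.card_le_card fun j hj => ?_) (h x))).false
  exact Finset.mem_filter.2 ⟨(Finset.mem_filter.1 hj).1, hx j hj⟩

end Sparse

/-! ### Building an array row by row. -/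

section Rows

open Filter Topology

variable {M : Type (max u v w)} [L.Structure M] [Nonempty M] {n m : ℕ}

/-- The finitary measures of `exists_spread` are glued along an ultrafilter containing, for each
definable set, the family of all finite `F` to which it belongs; the bound then holds for every set
defined over `M`. -/
theorem HasLargeSparse.exists_extension {μ : KeislerMeasure L M n}
    {φ : L.Formula (Fin n ⊕ Fin m)} {k : ℕ} {ε : ℝ} (h : HasLargeSparse μ φ k ε) {K : ℕ}
    (hK : 0 < K) {δ : ℝ} (hδ : 0 < δ) :
    ∃ (E : MeasureExtension.{u, v, max u v w} μ) (b : ℕ → Fin m → E.N), Sparse φ k K b ∧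
      ε ≤ ∑ j ∈ Finset.range K, E.ν.toFun (definedBy φ (b j)) ∧
      ∀ j < K, ∀ (m' : ℕ) (ψ : L.Formula (Fin n ⊕ Fin m')) (c : Fin m' → M),
        E.ν.toFun (definedBy φ (b j) ⊓ definedBy ψ (E.f ∘ c)) ≤
          μ.toFun (definedBy ψ c) / K + δ := by
  classical
  choose b ρ hb hρF hρε hρδ using fun F => h.exists_spread hK hδ F
  let U : Ultrafilter (Finset (L.DefinableSet (Set.univ : Set M) (Fin n))) := Ultrafilter.of atTop
  have hmem : ∀ X : L.DefinableSet (Set.univ : Set M) (Fin n),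
      ∀ᶠ F : Finset (L.DefinableSet (Set.univ : Set M) (Fin n)) in U, X ∈ F := fun X =>
    Ultrafilter.of_le atTop
      ((eventually_ge_atTop {X}).mono fun F hF => Finset.singleton_subset_iff.1 hF)
  refine ⟨MeasureExtension.ultrapower U μ ρ fun X => (hmem X).mono
    fun F hF => hρF F X hF, fun j => ultraTuple U fun l F => b F j l,
    sparse_ultraTuple (Eventually.of_forall hb), ?_, fun j hj m' ψ c => ?_⟩
  · exact ge_of_tendsto' (tendsto_finsetSum _ fun j _ => tendsto_ultraMeasure ρ
      (represents_definedBy φ fun l F => b F j l)) hρε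
  · have h1 := (represents_definedBy (U := U) φ fun l F => b F j l).inf
      (represents_definedBy ψ fun l _ => c l)
    refine le_of_tendsto (tendsto_ultraMeasure ρ h1) ?_
    exact (hmem (definedBy ψ c)).mono fun F hF => hρδ F j hj _ hF

/-- The recursively defined bound for the measure of an intersection of `s` formulas taken from
different rows of an array. -/
noncomputable def cellBound (K : ℕ) (δ : ℝ) : ℕ → ℝ
  | 0 => 1
  | s + 1 => cellBound K δ s / K + δ

theorem cellBound_le {K : ℕ} (hK : 0 < K) (R : ℕ) {s : ℕ} (hs : s ≤ R) :
    cellBound K (1 / (K : ℝ) ^ R) s ≤ (s + 1) / (K : ℝ) ^ s := by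
  have hKR : (1 : ℝ) ≤ K := by exact_mod_cast hK
  induction s with
  | zero => simp [cellBound]
  | succ s ih =>
    have h1 := ih (by omega)
    have h2 : 1 / (K : ℝ) ^ R ≤ 1 / (K : ℝ) ^ (s + 1) :=
      one_div_le_one_div_of_le (by positivity) (pow_le_pow_right₀ hKR hs)
    have h3 : cellBound K (1 / (K : ℝ) ^ R) s / K ≤ (s + 1) / (K : ℝ) ^ s / K :=
      div_le_div_of_nonneg_right h1 (by positivity)
    rw [cellBound]
    refine (add_le_add h3 h2).trans (le_of_eq ?_)
    rw [pow_succ]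
    push_cast
    field_simp

/-- Each new row is spread over the model containing the previous rows, whose cells are sets defined
over that model. Adding an instance of the new row to a cell thus divides the bound by `K` and adds
`δ`. -/
theorem exists_rows {μ : KeislerMeasure L M n} {φ : L.Formula (Fin n ⊕ Fin m)} {k : ℕ} {ε : ℝ}
    (hμ : HasLargeSparse μ φ k ε)
    (h : ∀ E : MeasureExtension.{u, v, max u v w} μ, HasLargeSparse E.ν φ k ε) {K : ℕ}
    (hK : 0 < K) {δ : ℝ} (hδ : 0 < δ) (R : ℕ) :
    ∃ (E : MeasureExtension.{u, v, max u v w} μ) (b : ℕ → ℕ → Fin m → E.N),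
      (∀ i < R, Sparse φ k K (b i)) ∧
      (∀ i < R, ε ≤ ∑ j ∈ Finset.range K, E.ν.toFun (definedBy φ (b i j))) ∧
      ∀ S ⊆ Finset.range R, ∀ η : ℕ → ℕ, (∀ i ∈ S, η i < K) →
        E.ν.toFun (S.inf fun i => definedBy φ (b i (η i))) ≤ cellBound K δ S.card := by
  classical
  induction R with
  | zero =>
    obtain ⟨E, b, -⟩ := hμ.exists_extension hK hδ
    refine ⟨E, fun _ => b, by simp, by simp, fun S hS η _ => ?_⟩
    rw [Finset.range_zero, Finset.subset_empty] at hS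
    subst hS
    exact E.ν.le_one _
  | succ R ih =>
    obtain ⟨E, b, hb, hbε, hcell⟩ := ih
    have : Nonempty E.N := E.nonempty
    obtain ⟨E', b', hb', hbε', hcell'⟩ := (h E).exists_extension hK hδ
    let a : ℕ → ℕ → Fin m → E'.N := fun i j => if i < R then E'.f ∘ b i j else b' j
    have ha : ∀ i < R, ∀ j, a i j = E'.f ∘ b i j := fun i hi j => if_pos hi
    have ha' : ∀ j, a R j = b' j := fun j => if_neg (lt_irrefl R)
    have hold : ∀ S ⊆ Finset.range R, ∀ η : ℕ → ℕ, (∀ i ∈ S, η i < K) →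
        ∃ (m' : ℕ) (ψ : L.Formula (Fin n ⊕ Fin m')) (c : Fin m' → E.N),
          S.inf (fun i => definedBy φ (a i (η i))) = definedBy ψ (E'.f ∘ c) ∧
          E.ν.toFun (definedBy ψ c) ≤ cellBound K δ S.card := by
      intro S hS η hη
      obtain ⟨m', ψ, c, h1, h2⟩ := exists_inf_eq_definedBy E'.f φ (fun i => b i (η i)) S
      refine ⟨m', ψ, c, ?_, h1 ▸ hcell S hS η hη⟩
      rw [← h2]
      exact Finset.inf_congr rfl fun i hi => by rw [ha i (Finset.mem_range.1 (hS hi))]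
    refine ⟨E.comp E', a, fun i hi => ?_, fun i hi => ?_, fun S hS η hη => ?_⟩
    · rcases Nat.lt_succ_iff_lt_or_eq.1 hi with hi | rfl
      · rw [show a i = fun j => E'.f ∘ b i j from funext (ha i hi)]
        exact (hb i hi).map E'.f
      · rw [show a i = b' from funext ha']
        exact hb'
    · rcases Nat.lt_succ_iff_lt_or_eq.1 hi with hi | rfl
      · refine (hbε i hi).trans (le_of_eq (Finset.sum_congr rfl fun j _ => ?_))
        rw [ha i hi]
        exact (E'.ext m φ (b i j)).symm
      · rw [show a i = b' from funext ha']
        exact hbε'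
    · change E'.ν.toFun (S.inf fun i => definedBy (M := E'.N) φ (a i (η i))) ≤ _
      by_cases hR : R ∈ S
      · have hS' : S.erase R ⊆ Finset.range R := fun i hi => by
          have h1 := Finset.mem_range.1 (hS (Finset.mem_of_mem_erase hi))
          have h2 := Finset.ne_of_mem_erase hi
          exact Finset.mem_range.2 (by omega)
        obtain ⟨m', ψ, c, h1, h2⟩ := hold _ hS' η fun i hi => hη i (Finset.mem_of_mem_erase hi)
        rw [← Finset.insert_erase hR, Finset.inf_insert, h1, ha',
          Finset.card_insert_of_notMem (Finset.notMem_erase R S), cellBound]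
        refine (hcell' _ (hη R hR) m' ψ c).trans ?_
        gcongr
      · have hS' : S ⊆ Finset.range R := fun i hi => by
          have h1 := Finset.mem_range.1 (hS hi)
          have h2 : i ≠ R := fun h => hR (h ▸ hi)
          exact Finset.mem_range.2 (by omega)
        obtain ⟨m', ψ, c, h1, h2⟩ := hold _ hS' η hη
        rw [h1]
        refine le_trans (le_of_eq ?_) h2
        exact E'.ext m' ψ c

end Rows

/-! ### Extracting a square array with consistent paths. -/

section Grid

/-- The unions of some `r` rows meet in mass at least `ε / k / 2 / 2 ^ R`. Every cell has mass at
most `(r + 1) / K ^ r`, so at least `c * K ^ r` cells must be nonempty, and `hgrid` applies to the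
set of nonempty cells. -/
theorem exists_grid_of_cells {N : Type w} [L.Structure N] [Nonempty N] {n m : ℕ}
    (ν : KeislerMeasure L N n) {φ : L.Formula (Fin n ⊕ Fin m)} {k : ℕ} {ε : ℝ} (hε : 0 < ε)
    (hk : 0 < k) {K R r : ℕ} {c : ℝ} (hR : 0 < R) (hRr : 2 * r ≤ ε / k * R)
    (b : ℕ → ℕ → Fin m → N) (hb : ∀ i < R, Sparse φ k K (b i))
    (hbε : ∀ i < R, ε ≤ ∑ j ∈ Finset.range K, ν.toFun (definedBy φ (b i j)))
    (hcell : ∀ S ⊆ Finset.range R, S.card = r → ∀ η : ℕ → ℕ, (∀ i ∈ S, η i < K) →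
      ν.toFun (S.inf fun i => definedBy φ (b i (η i))) ≤ (r + 1) / (K : ℝ) ^ r)
    (hc : c = ε / k / 2 / 2 ^ R / (r + 1)) (hK : 0 < K)
    (hgrid : ∀ C : Finset (Fin r → Fin K), c * (K : ℝ) ^ r ≤ C.card →
      ∃ S : Fin r → Finset (Fin K), (∀ i, (S i).card = r) ∧
        ∀ η : Fin r → Fin K, (∀ i, η i ∈ S i) → η ∈ C) :
    ∃ a : ℕ → ℕ → Fin m → N, (∀ i < r, Sparse φ k r (a i)) ∧
      ∀ η : ℕ → ℕ, (∀ i < r, η i < r) → ∃ x : Fin n → N, ∀ i < r, x ∈ definedBy φ (a i (η i)) := by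
  classical
  have hkR : (0 : ℝ) < k := by exact_mod_cast hk
  have hKR : (0 : ℝ) < K := by exact_mod_cast hK
  let F₀ : Finset (L.DefinableSet (Set.univ : Set N) (Fin n)) :=
    (Finset.range R ×ˢ Finset.range K).image fun p => definedBy φ (b p.1 p.2)
  have hF₀ : ∀ i < R, ∀ j < K, definedBy φ (b i j) ∈ F₀ := fun i hi j hj =>
    Finset.mem_image.2 ⟨(i, j), Finset.mem_product.2 ⟨Finset.mem_range.2 hi,
      Finset.mem_range.2 hj⟩, rfl⟩
  -- Including all intersections lets the finitely many weighted points compute the measures of the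
  -- cells exactly.
  let F := F₀.powerset.image fun s => s.inf id
  have hF : ∀ s ⊆ F₀, s.inf id ∈ F := fun s hs =>
    Finset.mem_image.2 ⟨s, Finset.mem_powerset.2 hs, rfl⟩
  have hF1 : ∀ i < R, ∀ j < K, definedBy φ (b i j) ∈ F := fun i hi j hj => by
    have h1 := hF {definedBy φ (b i j)} (Finset.singleton_subset_iff.2 (hF₀ i hi j hj))
    rwa [Finset.inf_singleton] at h1
  obtain ⟨q, hq, -⟩ := ν.exists_points F ⊤
  set p := fun σ => ν.toFun (KeislerMeasure.atom F σ) with hp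
  have hp0 : ∀ σ, 0 ≤ p σ := fun σ => ν.nonneg _
  have hp1 : ∑ σ ∈ F.powerset, p σ = 1 := ν.sum_atom F
  -- The instances of a row have total mass at least `ε` and cover each point fewer than `k` times.
  have hrow : ∀ i < R, ε / k ≤
      ∑ σ ∈ F.powerset with ∃ j < K, q σ ∈ definedBy φ (b i j), p σ := by
    intro i hi
    rw [div_le_iff₀ hkR]
    refine (hbε i hi).trans ?_
    have h1 : ∀ j ∈ Finset.range K, ν.toFun (definedBy φ (b i j)) =
        ∑ σ ∈ F.powerset, if q σ ∈ definedBy φ (b i j) then p σ else 0 := fun j hj => by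
      rw [← Finset.sum_filter]
      exact (hq _ (hF1 i hi j (Finset.mem_range.1 hj))).symm
    rw [Finset.sum_congr rfl h1, Finset.sum_comm, Finset.sum_filter, Finset.sum_mul]
    refine Finset.sum_le_sum fun σ _ => ?_
    rw [← Finset.sum_filter, Finset.sum_const, nsmul_eq_mul]
    split_ifs with h2
    · rw [mul_comm]
      refine mul_le_mul_of_nonneg_left ?_ (hp0 σ)
      exact_mod_cast (hb i hi (q σ)).le
    · rw [Finset.filter_false_of_mem fun j hj hjσ => h2 ⟨j, Finset.mem_range.1 hj, hjσ⟩]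
      simp
  obtain ⟨T, hTR, hTr, hT⟩ := exists_subset_le_sum_inter F.powerset p (fun σ _ => hp0 σ) hp1.le
    (Finset.range R) (fun i σ => ∃ j < K, q σ ∈ definedBy φ (b i j)) (ε / k) (by positivity) r
    (by rwa [Finset.card_range])
    (by
      rw [mul_comm, ← nsmul_eq_mul, ← Finset.sum_const]
      exact Finset.sum_le_sum fun i hi => hrow i (Finset.mem_range.1 hi))
    (by rwa [Finset.card_range])
  rw [Finset.card_range] at hT
  let e : Fin r → ℕ := T.orderEmbOfFin hTr
  have heT : ∀ i, e i ∈ T := fun i => T.orderEmbOfFin_mem hTr i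
  have heR : ∀ i, e i < R := fun i => Finset.mem_range.1 (hTR (heT i))
  have hesurj : ∀ t ∈ T, ∃ i, e i = t := fun t ht => by
    have : t ∈ Set.range (T.orderEmbOfFin hTr) := by
      rw [Finset.range_orderEmbOfFin]
      exact ht
    exact this
  have heinj : Function.Injective e := (T.orderEmbOfFin hTr).injective
  let C : Finset (Fin r → Fin K) :=
    Finset.univ.filter fun η => ∃ x, ∀ i, x ∈ definedBy φ (b (e i) (η i))
  have hcellq : ∀ η : Fin r → Fin K,
      ∑ σ ∈ F.powerset with ∀ i, q σ ∈ definedBy φ (b (e i) (η i)), p σ ≤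
        (r + 1) / (K : ℝ) ^ r := by
    intro η
    let η' : ℕ → ℕ := fun t => if h : ∃ i, e i = t then η h.choose else 0
    have hη' : ∀ i, η' (e i) = η i := fun i => by
      have h : ∃ i', e i' = e i := ⟨i, rfl⟩
      simp only [η', dif_pos h]
      rw [heinj h.choose_spec]
    have h2 := hcell T hTR hTr η' fun t ht => by
      obtain ⟨i, rfl⟩ := hesurj t ht
      rw [hη' i]
      exact (η i).2
    refine le_trans (le_of_eq ?_) h2
    have h3 : T.inf (fun i => definedBy φ (b i (η' i))) =
        (T.image fun i => definedBy φ (b i (η' i))).inf id := by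
      rw [Finset.inf_image]
      rfl
    have h4 : T.inf (fun i => definedBy φ (b i (η' i))) ∈ F := by
      rw [h3]
      refine hF _ fun X hX => ?_
      obtain ⟨t, ht, rfl⟩ := Finset.mem_image.1 hX
      obtain ⟨i, rfl⟩ := hesurj t ht
      rw [hη' i]
      exact hF₀ _ (heR i) _ (η i).2
    rw [← hq _ h4]
    congr 1
    refine Finset.filter_congr fun σ _ => ?_
    rw [mem_finset_inf]
    constructor
    · intro h t ht
      obtain ⟨i, rfl⟩ := hesurj t ht
      rw [hη' i]
      exact h i
    · intro h i
      have := h (e i) (heT i)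
      rwa [hη' i] at this
  have hC : c * (K : ℝ) ^ r ≤ C.card := by
    -- A point in the unions of all the chosen rows lies in some cell, which it shows to be
    -- nonempty.
    have h1 : ∑ σ ∈ F.powerset with ∀ i ∈ T, ∃ j < K, q σ ∈ definedBy φ (b i j), p σ ≤
        ∑ η ∈ C, ∑ σ ∈ F.powerset with ∀ i, q σ ∈ definedBy φ (b (e i) (η i)), p σ := by
      simp_rw [Finset.sum_filter]
      rw [Finset.sum_comm]
      refine Finset.sum_le_sum fun σ _ => ?_
      have hnn : ∀ η ∈ C, 0 ≤ if ∀ i, q σ ∈ definedBy φ (b (e i) (η i)) then p σ else 0 :=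
        fun η _ => by
          split_ifs
          · exact hp0 σ
          · exact le_rfl
      split_ifs with h
      · choose η hη hηq using fun i => h (e i) (heT i)
        have h2 : ∀ i, q σ ∈ definedBy φ (b (e i) ((⟨η i, hη i⟩ : Fin K) : ℕ)) := hηq
        have := Finset.single_le_sum hnn (a := fun i => ⟨η i, hη i⟩)
          (Finset.mem_filter.2 ⟨Finset.mem_univ _, q σ, h2⟩)
        rwa [if_pos h2] at this
      · exact Finset.sum_nonneg hnn
    have h2 := hT.trans (h1.trans (Finset.sum_le_sum fun η _ => hcellq η))
    rw [Finset.sum_const, nsmul_eq_mul, mul_div_assoc', le_div_iff₀ (by positivity)] at h2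
    rw [hc, div_mul_eq_mul_div, div_le_iff₀ (by positivity)]
    exact h2
  obtain ⟨S, hSr, hS⟩ := hgrid C hC
  let s : ℕ → ℕ → ℕ := fun i j => if h : i < r ∧ j < r then
    (S ⟨i, h.1⟩).orderEmbOfFin (hSr _) ⟨j, h.2⟩ else 0
  have hs : ∀ i (hi : i < r), ∀ j (hj : j < r),
      s i j = ((S ⟨i, hi⟩).orderEmbOfFin (hSr _) ⟨j, hj⟩ : Fin K) :=
    fun i hi j hj => dif_pos ⟨hi, hj⟩
  let a : ℕ → ℕ → Fin m → N := fun i j => if h : i < r then b (e ⟨i, h⟩) (s i j) else b 0 0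
  have ha : ∀ i (hi : i < r), a i = fun j => b (e ⟨i, hi⟩) (s i j) := fun i hi =>
    funext fun j => dif_pos hi
  refine ⟨a, fun i hi => ?_, fun η hη => ?_⟩
  · rw [ha i hi]
    refine (hb _ (heR _)).comp (s i) (fun j hj => ?_) fun j hj j' hj' h => ?_
    · rw [hs i hi j hj]
      exact Fin.is_lt _
    · rw [hs i hi j hj, hs i hi j' hj'] at h
      exact congrArg Fin.val (((S ⟨i, hi⟩).orderEmbOfFin (hSr _)).injective (Fin.ext h))
  · have h1 := hS (fun i => (S i).orderEmbOfFin (hSr i) ⟨η i, hη i i.2⟩)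
      fun i => (S i).orderEmbOfFin_mem (hSr i) _
    obtain ⟨x, hx⟩ := (Finset.mem_filter.1 h1).2
    refine ⟨x, fun i hi => ?_⟩
    rw [ha i hi]
    simp only [hs i hi _ (hη i hi)]
    exact hx ⟨i, hi⟩

theorem exists_grid {M : Type (max u v w)} [L.Structure M] [Nonempty M] {n m : ℕ}
    {μ : KeislerMeasure L M n} {φ : L.Formula (Fin n ⊕ Fin m)} {k : ℕ} {ε : ℝ} (hε : 0 < ε)
    (hμ : HasLargeSparse μ φ k ε)
    (h : ∀ E : MeasureExtension.{u, v, max u v w} μ, HasLargeSparse E.ν φ k ε) (r : ℕ) :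
    ∃ (E : MeasureExtension.{u, v, max u v w} μ) (a : ℕ → ℕ → Fin m → E.N),
      (∀ i < r, Sparse φ k r (a i)) ∧ ∀ η : ℕ → ℕ, (∀ i < r, η i < r) →
        ∃ x : Fin n → E.N, ∀ i < r, x ∈ definedBy φ (a i (η i)) := by
  have hk : 0 < k := by
    obtain ⟨b, hb, -⟩ := hμ 0 ∅ (by simp)
    exact lt_of_le_of_lt (Nat.zero_le _) (hb fun _ => Classical.arbitrary M)
  have hkR : (0 : ℝ) < k := by exact_mod_cast hk
  -- The first term lets the counting lemma find `r` overlapping rows, `1` makes `R` positive, and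
  -- `r` ensures `r ≤ R`, as `cellBound_le` requires. `K` is chosen only after `R`, because the
  -- density depends on `R`.
  obtain ⟨R, hR⟩ := exists_nat_ge (2 * r / (ε / k) + 1 + r)
  have h0 : 0 ≤ 2 * r / (ε / k) := by positivity
  have hr0 : (0 : ℝ) ≤ r := Nat.cast_nonneg r
  have hR0 : 0 < R := by
    have : (0 : ℝ) < R := by linarith
    exact_mod_cast this
  have hrR : r ≤ R := by
    have : (r : ℝ) ≤ R := by linarith
    exact_mod_cast this
  have hRr : 2 * r ≤ ε / k * R := by
    have : 2 * r / (ε / k) ≤ R := by linarith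
    rwa [div_le_iff₀ (by positivity), mul_comm (R : ℝ)] at this
  obtain ⟨K₀, hK₀⟩ := exists_grid_subset r r (ε / k / 2 / 2 ^ R / (r + 1)) (by positivity)
  have hK : 0 < max 1 K₀ := lt_of_lt_of_le one_pos (le_max_left _ _)
  have hKR : (0 : ℝ) < (max 1 K₀ : ℕ) := by exact_mod_cast hK
  obtain ⟨E, b, hb, hbε, hcell⟩ := exists_rows hμ h hK
    (δ := 1 / ((max 1 K₀ : ℕ) : ℝ) ^ R) (by positivity) R
  have : Nonempty E.N := E.nonempty
  refine ⟨E, exists_grid_of_cells E.ν hε hk hR0 hRr b hb hbε (fun S hS hSr η hη => ?_) rfl hK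
    (hK₀ _ (le_max_right _ _))⟩
  have h1 := hcell S hS η hη
  rw [hSr] at h1
  exact h1.trans (cellBound_le hK R hrR)

end Grid

/-! ### From finite arrays to the tree property of the second kind. -/

section TP2

open Filter

variable {n m : ℕ}

/-- The formula saying that finitely many instances of `φ` have a common realization. -/
noncomputable def commonFormula {ι : Type*} (φ : L.Formula (Fin n ⊕ Fin m)) (s : Finset ι) :
    L.Formula (ι × Fin m) :=
  (Formula.iInf fun i : s => φ.relabel
    (Sum.elim Sum.inr fun l => Sum.inl ((i : ι), l) : Fin n ⊕ Fin m → (ι × Fin m) ⊕ Fin n)).iExs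
    (Fin n)

theorem realize_commonFormula {ι : Type*} {φ : L.Formula (Fin n ⊕ Fin m)} {s : Finset ι}
    {M : Type w} [L.Structure M] {a : ι × Fin m → M} :
    (commonFormula φ s).Realize a ↔
      ∃ x : Fin n → M, ∀ i ∈ s, φ.Realize (Sum.elim x fun l => a (i, l)) := by
  rw [commonFormula, Formula.realize_iExs]
  refine exists_congr fun x => ?_
  rw [Formula.realize_iInf, Subtype.forall]
  refine forall₂_congr fun i _ => ?_
  rw [Formula.realize_relabel]
  refine iff_of_eq (congrArg _ ?_)
  funext l
  rcases l with l | l <;> rfl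

/-- An array witnessing the tree property of the second kind may be given in a model of `T` in any
universe. -/
theorem hasTP2_of_model {T : L.Theory} {φ : L.Formula (Fin n ⊕ Fin m)} (P : Type w)
    [L.Structure P] [Nonempty P] [P ⊨ T] (a : ℕ → ℕ → Fin m → P) (k : ℕ)
    (ha : ∀ η : ℕ → ℕ, ConsistentFamily φ fun i => a i (η i)) (hk : ∀ i, KInconsistent φ k (a i)) :
    HasTP2 T φ := by
  let v : (ℕ × ℕ) × Fin m → P := fun p => a p.1.1 p.1.2 p.2
  let := constantsOn.structure v
  -- Naming only the array by constants keeps the language small, so its complete theory has a model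
  -- in the universe required by `HasTP2`.
  obtain ⟨Q⟩ := Theory.Model.isSatisfiable (T := L[[(ℕ × ℕ) × Fin m]].completeTheory P) P
  let : L.Structure Q := (L.lhomWithConstants ((ℕ × ℕ) × Fin m)).reduct Q
  have : (L.lhomWithConstants ((ℕ × ℕ) × Fin m)).IsExpansionOn Q :=
    LHom.isExpansionOn_reduct _ _
  let c : (ℕ × ℕ) × Fin m → Q := fun p => (L.con p : Q)
  have htransfer : ∀ ψ : L.Formula ((ℕ × ℕ) × Fin m), ψ.Realize c ↔ ψ.Realize v := by
    intro ψ
    have h1 := Formula.realize_equivSentence Q ψ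
    have h2 := Formula.realize_equivSentence P ψ
    have h3 := realize_iff_of_model_completeTheory (L := L[[(ℕ × ℕ) × Fin m]]) P Q
      (Formula.equivSentence ψ)
    exact h1.symm.trans (h3.trans h2)
  have hcommon : ∀ s : Finset (ℕ × ℕ),
      (∃ x : Fin n → Q, ∀ i ∈ s, φ.Realize (Sum.elim x fun l => c (i, l))) ↔
        ∃ x : Fin n → P, ∀ i ∈ s, φ.Realize (Sum.elim x fun l => v (i, l)) := fun s => by
    rw [← realize_commonFormula, ← realize_commonFormula, htransfer]
  have : Q ⊨ T := by
    refine Theory.model_iff_subset_completeTheory.2 fun ψ hψ => ?_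
    have h1 : P ⊨ ψ := Theory.realize_sentence_of_mem T hψ
    have h2 := (LHom.realize_onSentence P (L.lhomWithConstants ((ℕ × ℕ) × Fin m)) ψ).2 h1
    have h3 := (realize_iff_of_model_completeTheory (L := L[[(ℕ × ℕ) × Fin m]]) P Q _).2 h2
    exact (LHom.realize_onSentence Q (L.lhomWithConstants ((ℕ × ℕ) × Fin m)) ψ).1 h3
  refine ⟨Theory.ModelType.of T Q, fun i j l => c ((i, j), l), k, fun η s => ?_,
    fun i s hs hx => ?_⟩
  · obtain ⟨x, hx⟩ := ha η s
    obtain ⟨y, hy⟩ := (hcommon (s.image fun i => (i, η i))).2 ⟨x, fun p hp => by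
      obtain ⟨i, hi, rfl⟩ := Finset.mem_image.1 hp
      exact hx i hi⟩
    exact ⟨y, fun i hi => hy (i, η i) (Finset.mem_image_of_mem _ hi)⟩
  · obtain ⟨y, hy⟩ := hx
    obtain ⟨x, hx⟩ := (hcommon (s.image fun j => (i, j))).1 ⟨y, fun p hp => by
      obtain ⟨j, hj, rfl⟩ := Finset.mem_image.1 hp
      exact hy j hj⟩
    exact hk i s hs ⟨x, fun j hj => hx (i, j) (Finset.mem_image_of_mem _ hj)⟩

theorem Sparse.kInconsistent {N : Type w} [L.Structure N] {φ : L.Formula (Fin n ⊕ Fin m)}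
    {k : ℕ} {b : ℕ → Fin m → N} (h : ∀ K, Sparse φ k K b) : KInconsistent φ k b := by
  classical
  rintro s hs ⟨x, hx⟩
  obtain ⟨K, hK⟩ := s.exists_nat_subset_range
  refine (h K x).not_ge (hs ▸ Finset.card_le_card fun j hj => ?_)
  exact Finset.mem_filter.2 ⟨hK hj, hx j hj⟩

/-- Finite arrays of all sizes yield the tree property of the second kind. -/
theorem hasTP2_of_grids {T : L.Theory} {φ : L.Formula (Fin n ⊕ Fin m)} {k : ℕ} (N : ℕ → Type w)
    [∀ r, L.Structure (N r)] [∀ r, Nonempty (N r)] [∀ r, N r ⊨ T]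
    (a : ∀ r, ℕ → ℕ → Fin m → N r) (hk : ∀ r, ∀ i < r, Sparse φ k r (a r i))
    (ha : ∀ r, ∀ η : ℕ → ℕ, (∀ i < r, η i < r) →
      ∃ x : Fin n → N r, ∀ i < r, x ∈ definedBy φ (a r i (η i))) : HasTP2 T φ := by
  classical
  let U : Ultrafilter ℕ := hyperfilter ℕ
  have hU : ∀ s, ∀ᶠ r : ℕ in U, s < r := fun s =>
    (Nat.hyperfilter_le_atTop) (eventually_gt_atTop s)
  have : (U : Filter ℕ).Product N ⊨ T := Theory.model_iff _ |>.2 fun ψ hψ =>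
    (Ultraproduct.sentence_realize ψ).2 (Eventually.of_forall fun r =>
      Theory.realize_sentence_of_mem T hψ)
  refine hasTP2_of_model ((U : Filter ℕ).Product N)
    (fun i j => ultraTuple U fun l r => a r i j l) k (fun η s => ?_) fun i => ?_
  · have hx : ∀ r, ∃ x : Fin n → N r, (∀ i ∈ s, i < r ∧ η i < r) →
        ∀ i ∈ s, x ∈ definedBy φ (a r i (η i)) := by
      intro r
      by_cases hs : ∀ i ∈ s, i < r ∧ η i < r
      · by_cases hr : 0 < r
        -- The path is reset to 0 off `s` because it must stay below `r` in every row, not only in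
        -- those of `s`.
        · obtain ⟨x, hx⟩ := ha r (fun i => if i ∈ s then η i else 0) fun i _ => by
            split_ifs with his
            · exact (hs i his).2
            · exact hr
          refine ⟨x, fun _ i hi => ?_⟩
          have := hx i (hs i hi).1
          rwa [if_pos hi] at this
        · exact ⟨fun _ => Classical.arbitrary _, fun _ i hi =>
            (hr (lt_of_le_of_lt (Nat.zero_le _) (hs i hi).1)).elim⟩
      · exact ⟨fun _ => Classical.arbitrary _, fun h => (hs h).elim⟩
    choose x hx using hx
    refine ⟨ultraTuple U fun l r => x r l, fun i hi => ?_⟩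
    refine (represents_definedBy φ (fun l r => a r i (η i) l) (fun l r => x r l)).2 ?_
    have hev : ∀ᶠ r in U, ∀ i ∈ s, i < r ∧ η i < r :=
      (eventually_all_finset _).2 fun i _ => (hU i).and (hU (η i))
    exact hev.mono fun r hr => hx r hr i hi
  · refine Sparse.kInconsistent fun K => sparse_ultraTuple ?_
    filter_upwards [hU i, hU K] with r hi hr
    exact (hk r i hi).comp id (fun j hj => hj.trans hr) fun _ _ _ _ h => h

/-- If `φ` does not have the tree property of the second kind, then every Keisler measure extends
to one without large inconsistent families of instances of `φ`. -/
theorem exists_extension_not_hasLargeSparse {T : L.Theory} {M : Type (max u v w)} [L.Structure M]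
    [Nonempty M] [M ⊨ T] (μ : KeislerMeasure L M n) (φ : L.Formula (Fin n ⊕ Fin m))
    (hφ : ¬ HasTP2 T φ) (k : ℕ) {ε : ℝ} (hε : 0 < ε) (hμ : HasLargeSparse μ φ k ε) :
    ∃ E : MeasureExtension.{u, v, max u v w} μ, ¬ HasLargeSparse E.ν φ k ε := by
  by_contra! hcon
  choose E a hk ha using fun r => exists_grid hε hμ hcon r
  have : ∀ r, Nonempty (E r).N := fun r => (E r).nonempty
  have : ∀ r, (E r).N ⊨ T := fun r => ((E r).f.theory_model_iff T).1 inferInstance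
  exact hφ (hasTP2_of_grids (fun r => (E r).N) a hk ha)

end TP2

/-! ### The covering property as a first-order condition, and smoothness. -/

section Covering

variable {n m : ℕ}

theorem sparse_iff {N : Type w} [L.Structure N] {φ : L.Formula (Fin n ⊕ Fin m)} {k K : ℕ}
    {b : ℕ → Fin m → N} : Sparse φ k K b ↔ ∀ s : Finset (Fin K), s.card = k →
      ¬ ∃ x : Fin n → N, ∀ i ∈ s, φ.Realize (Sum.elim x (b i)) := by
  classical
  constructor
  · rintro h s hs ⟨x, hx⟩
    refine (h x).not_ge (hs ▸ ?_)
    refine Finset.card_le_card_of_injOn Fin.val (fun i hi => ?_) Fin.val_injective.injOn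
    exact Finset.mem_filter.2 ⟨Finset.mem_range.2 i.2, hx i hi⟩
  · intro h x
    by_contra! hx
    obtain ⟨t, ht, htk⟩ := Finset.exists_subset_card_eq hx
    have htK : ∀ j ∈ t, j < K := fun j hj =>
      Finset.mem_range.1 (Finset.mem_filter.1 (ht hj)).1
    refine h (t.attachFin htK) (by rw [Finset.card_attachFin, htk]) ⟨x, fun i hi => ?_⟩
    exact (Finset.mem_filter.1 (ht (Finset.mem_attachFin htK |>.1 hi))).2

theorem KInconsistent.sparse {N : Type w} [L.Structure N] {φ : L.Formula (Fin n ⊕ Fin m)}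
    {k : ℕ} {b : ℕ → Fin m → N} (h : KInconsistent φ k b) (K : ℕ) : Sparse φ k K b := by
  classical
  refine sparse_iff.2 fun s hs ⟨x, hx⟩ => h (s.map Fin.valEmbedding) (by simpa using hs) ⟨x, ?_⟩
  intro i hi
  obtain ⟨j, hj, rfl⟩ := Finset.mem_map.1 hi
  exact hx j hj

/-- The formula saying that in every `k`-inconsistent family of `K` instances of `φ` some member is
contained in one of the sets defined by `X l`, `l < r`. -/
noncomputable def coveringFormula (φ : L.Formula (Fin n ⊕ Fin m)) (k K r : ℕ) {d : ℕ → ℕ}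
    (X : ∀ l, L.Formula (Fin n ⊕ Fin (d l))) : L.Formula (Σ l, Fin (d l)) :=
  Formula.iAlls (Fin K × Fin m)
    ((Formula.iInf fun s : {s : Finset (Fin K) // s.card = k} =>
      ((commonFormula φ (s : Finset (Fin K))).relabel Sum.inr).not).imp
    (Formula.iSup fun p : Fin K × Fin r => (leFormula φ (X p.2)).relabel
      (Sum.elim (fun i => Sum.inr (p.1, i)) fun i => Sum.inl ⟨p.2, i⟩)))

theorem realize_coveringFormula {N : Type w} [L.Structure N] [Nonempty N]
    {φ : L.Formula (Fin n ⊕ Fin m)} {k K r : ℕ} {d : ℕ → ℕ}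
    {X : ∀ l, L.Formula (Fin n ⊕ Fin (d l))} {c : ∀ l, Fin (d l) → N} :
    (coveringFormula φ k K r X).Realize (fun p => c p.1 p.2) ↔
      ∀ b : ℕ → Fin m → N, Sparse φ k K b →
        ∃ j < K, ∃ l < r, definedBy φ (b j) ≤ definedBy (X l) (c l) := by
  classical
  rw [coveringFormula, Formula.realize_iAlls]
  have key : ∀ (y : Fin K × Fin m → N) (b : ℕ → Fin m → N),
      (∀ (j : Fin K) i, y (j, i) = b j i) →
      ((((Formula.iInf fun s : {s : Finset (Fin K) // s.card = k} =>
        ((commonFormula φ (s : Finset (Fin K))).relabel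
          (Sum.inr : _ → (Σ l, Fin (d l)) ⊕ (Fin K × Fin m))).not).imp
      (Formula.iSup fun p : Fin K × Fin r => (leFormula φ (X p.2)).relabel
        (Sum.elim (fun i => Sum.inr (p.1, i)) fun i => Sum.inl ⟨(p.2 : ℕ), i⟩))).Realize
        (Sum.elim (fun p => c p.1 p.2) y)) ↔
      (Sparse φ k K b → ∃ j < K, ∃ l < r, definedBy φ (b j) ≤ definedBy (X l) (c l))) := by
    intro y b hy
    rw [Formula.realize_imp, Formula.realize_iInf, Formula.realize_iSup]
    refine imp_congr ?_ ?_
    · rw [sparse_iff, Subtype.forall]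
      refine forall₂_congr fun s hs => ?_
      rw [Formula.realize_not, Formula.realize_relabel, realize_commonFormula]
      refine not_congr (exists_congr fun x => forall₂_congr fun i _ => ?_)
      refine iff_of_eq (congrArg (fun z => φ.Realize (Sum.elim x z)) (funext fun l => hy i l))
    · have h1 : ∀ p : Fin K × Fin r, ((leFormula φ (X p.2)).relabel
          (Sum.elim (fun i => Sum.inr (p.1, i)) fun i => Sum.inl ⟨(p.2 : ℕ), i⟩) :
          L.Formula ((Σ l, Fin (d l)) ⊕ (Fin K × Fin m))).Realize
          (Sum.elim (fun p => c p.1 p.2) y) ↔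
          definedBy φ (b p.1) ≤ definedBy (X p.2) (c p.2) := by
        intro p
        rw [Formula.realize_relabel, realize_leFormula]
        have h2 : ((Sum.elim (fun p : Σ l, Fin (d l) => c p.1 p.2) y ∘
            Sum.elim (fun i => Sum.inr (p.1, i)) fun i => Sum.inl ⟨(p.2 : ℕ), i⟩) ∘ Sum.inl) =
            b p.1 := funext fun i => hy p.1 i
        rw [h2]
        rfl
      simp only [h1]
      constructor
      · rintro ⟨p, hp⟩
        exact ⟨p.1, p.1.2, p.2, p.2.2, hp⟩
      · rintro ⟨j, hj, l, hl, h⟩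
        exact ⟨(⟨j, hj⟩, ⟨l, hl⟩), h⟩
  constructor
  · intro h b
    exact (key (fun p => b p.1 p.2) b fun _ _ => rfl).1 (h _)
  · intro h y
    refine (key y (fun j i => if hj : j < K then y (⟨j, hj⟩, i) else Classical.arbitrary N)
      fun j i => ?_).2 (h _)
    rw [dif_pos j.2]

theorem exists_covering_of_not_hasLargeSparse {N : Type w} [L.Structure N] [Nonempty N]
    {ν : KeislerMeasure L N n} {φ : L.Formula (Fin n ⊕ Fin m)} {k : ℕ} {ε : ℝ}
    (h : ¬ HasLargeSparse ν φ k ε) :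
    ∃ (K r : ℕ) (d : ℕ → ℕ) (X : ∀ l, L.Formula (Fin n ⊕ Fin (d l))) (c : ∀ l, Fin (d l) → N),
      (coveringFormula φ k K r X).Realize (fun p => c p.1 p.2) ∧
      ∀ l < r, ν.toFun (definedBy (X l) (c l)) < ε := by
  rw [HasLargeSparse] at h
  push Not at h
  obtain ⟨K, F, hF, h⟩ := h
  -- The whole space fills the positions beyond `F.card`, which are never used.
  choose d X c hX using fun l : ℕ => exists_eq_definedBy
    (if hl : l < F.card then (F.equivFin.symm ⟨l, hl⟩ :
      L.DefinableSet (Set.univ : Set N) (Fin n)) else ⊤)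
  refine ⟨K, F.card, d, X, c, realize_coveringFormula.2 fun b hb => ?_, fun l hl => ?_⟩
  · obtain ⟨j, hj, Y, hY, hle⟩ := h b hb
    refine ⟨j, hj, F.equivFin ⟨Y, hY⟩, Fin.is_lt _, ?_⟩
    rw [← hX, dif_pos (Fin.is_lt _), Fin.eta, Equiv.symm_apply_apply]
    exact hle
  · rw [← hX, dif_pos hl]
    exact hF _ (Subtype.prop _)

theorem not_hasLargeSparse_of_covering {N : Type w} [L.Structure N] [Nonempty N]
    {ν : KeislerMeasure L N n} {φ : L.Formula (Fin n ⊕ Fin m)} {k : ℕ} {ε : ℝ} {K r : ℕ}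
    {d : ℕ → ℕ} {X : ∀ l, L.Formula (Fin n ⊕ Fin (d l))} {c : ∀ l, Fin (d l) → N}
    (h : (coveringFormula φ k K r X).Realize fun p => c p.1 p.2)
    (hν : ∀ l < r, ν.toFun (definedBy (X l) (c l)) < ε) : ¬ HasLargeSparse ν φ k ε := by
  classical
  intro hlarge
  obtain ⟨b, hb, hbF⟩ := hlarge K ((Finset.range r).image fun l => definedBy (X l) (c l))
    fun Y hY => by
      obtain ⟨l, hl, rfl⟩ := Finset.mem_image.1 hY
      exact hν l (Finset.mem_range.1 hl)
  obtain ⟨j, hj, l, hl, hle⟩ := realize_coveringFormula.1 h b hb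
  exact hbF j hj _ (Finset.mem_image_of_mem _ (Finset.mem_range.2 hl)) hle

/-- With `ε` the alleged positive measure of the dividing formula, the covering property over `N`,
read in the model of the indiscernible sequence, puts one member inside a set over `N` of measure
below `ε`. Inclusion in this set is a formula over the image of `N`, so it passes to the first
member, which is the dividing instance. -/
theorem isNTP2Smooth_of_not_hasLargeSparse {N : Type w} [L.Structure N] [Nonempty N]
    {ν : KeislerMeasure L N n}
    (h : ∀ (m : ℕ) (φ : L.Formula (Fin n ⊕ Fin m)) (k : ℕ) (ε : ℝ), 0 < ε →
      ¬ HasLargeSparse ν φ k ε) : ν.IsNTP2Smooth := by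
  intro N' _ g ν' hext m φ b
  rintro ⟨P, _, f, c, k, hc0, hind, hk⟩
  by_contra hne
  have hpos : 0 < ν'.toFun (definedBy φ b) := lt_of_le_of_ne (ν'.nonneg _) (Ne.symm hne)
  obtain ⟨K, r, d, X, e, hcov, hX⟩ := exists_covering_of_not_hasLargeSparse (h m φ k _ hpos)
  have : Nonempty P := ‹Nonempty N›.map (f.comp g)
  have hcovP : (coveringFormula φ k K r X).Realize fun p => (f ∘ g ∘ e p.1) p.2 :=
    ((f.comp g).map_formula _ _).2 hcov
  obtain ⟨j, -, l, hl, hle⟩ := realize_coveringFormula (c := fun l => f ∘ g ∘ e l) |>.1 hcovP c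
    (hk.sparse K)
  have hA : ∀ i, f (g (e l i)) ∈ f '' Set.range g := fun i =>
    Set.mem_image_of_mem _ (Set.mem_range_self _)
  have hrealize : ∀ j : ℕ, ((leFormula φ (X l)).relabel
      (Sum.elim (fun i => Sum.inr ((0 : Fin 1), i)) fun i => Sum.inl ⟨f (g (e l i)), hA i⟩) :
      L.Formula ((f '' Set.range g) ⊕ (Fin 1 × Fin m))).Realize
      (Sum.elim (fun a : (f '' Set.range g) => (a : P)) fun p => c ((fun _ => j) p.1) p.2) ↔
      definedBy φ (c j) ≤ definedBy (X l) (f ∘ g ∘ e l) := by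
    intro j
    rw [Formula.realize_relabel, realize_leFormula]
    rfl
  have hle0 : definedBy φ (c 0) ≤ definedBy (X l) (f ∘ g ∘ e l) :=
    (hrealize 0).1 ((hind 1 _ (fun _ => j) (fun _ => 0) (Subsingleton.strictMono _)
      (Subsingleton.strictMono _)).1 ((hrealize j).2 hle))
  rw [hc0] at hle0
  have h1 := (realize_leFormula (v := Sum.elim (f ∘ b) (f ∘ g ∘ e l))).2 hle0
  rw [← Sum.comp_elim, f.map_formula, realize_leFormula] at h1
  have h2 := ν'.mono h1
  have h3 := hext _ (X l) (e l)
  exact absurd (h2.trans_eq h3) (not_le.2 (hX l hl))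

end Covering

/-! ### Existentially closed extensions of measures. -/

section Existential

open Filter Topology

variable {n : ℕ}

variable (L n) in
/-- An existential condition on a Keisler measure: there are parameters satisfying `θ` such that
the formulas `X l`, `l < r`, with these parameters have measure at most `bound`. -/
structure Condition where
  /-- The number of formulas whose measure is bounded. -/
  r : ℕ
  /-- The numbers of parameters of the formulas. -/
  d : ℕ → ℕ
  /-- The formulas. -/
  X : ∀ l, L.Formula (Fin n ⊕ Fin (d l))
  /-- The first-order condition on the parameters. -/
  θ : L.Formula (Σ l, Fin (d l))
  /-- The bound of the measures. -/
  bound : ℝ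

/-- The condition `C` holds for the Keisler measure `ν`. -/
def Condition.Holds (C : Condition L n) {N : Type w} [L.Structure N] (ν : KeislerMeasure L N n) :
    Prop :=
  ∃ c : ∀ l, Fin (C.d l) → N, C.θ.Realize (fun p => c p.1 p.2) ∧
    ∀ l < C.r, ν.toFun (definedBy (C.X l) (c l)) ≤ C.bound

theorem Condition.Holds.extends {C : Condition L n} {M : Type w} {N : Type w'} [L.Structure M]
    [L.Structure N] {μ : KeislerMeasure L M n} {ν : KeislerMeasure L N n} {f : M ↪ₑ[L] N}
    (h : C.Holds μ) (hext : ν.Extends f μ) : C.Holds ν := by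
  obtain ⟨c, hθ, hc⟩ := h
  refine ⟨fun l => f ∘ c l, (f.map_formula C.θ _).2 hθ, fun l hl => ?_⟩
  rw [hext]
  exact hc l hl

/-- The bounds in a condition are non-strict, hence survive limits of measures; the first-order part
is Łoś's theorem. -/
theorem Condition.Holds.ultraproduct {C : Condition L n} {M : Type w} [L.Structure M]
    [Nonempty M] {μ : KeislerMeasure L M n} {I : Type (max u v)} {U : Ultrafilter I}
    {E : I → MeasureExtension.{u, v, w} μ} (h : ∀ᶠ i in U, C.Holds (E i).ν) :
    C.Holds (MeasureExtension.ultraproduct U E).ν := by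
  classical
  have : ∀ i, Nonempty (E i).N := fun i => (E i).nonempty
  have hc : ∀ i, ∃ c : ∀ l, Fin (C.d l) → (E i).N, C.Holds (E i).ν →
      C.θ.Realize (fun p => c p.1 p.2) ∧
        ∀ l < C.r, (E i).ν.toFun (definedBy (C.X l) (c l)) ≤ C.bound := fun i => by
    by_cases hi : C.Holds (E i).ν
    · exact ⟨hi.choose, fun _ => hi.choose_spec⟩
    · exact ⟨fun _ _ => Classical.arbitrary _, fun h => (hi h).elim⟩
  choose c hc using hc
  refine ⟨fun l => ultraTuple U fun p i => c i l p, ?_, fun l hl => ?_⟩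
  · exact (Ultraproduct.realize_formula_cast (u := U) C.θ fun p i => c i p.1 p.2).2
      (h.mono fun i hi => (hc i hi).1)
  · exact le_of_tendsto (tendsto_ultraMeasure _ (represents_definedBy (C.X l) fun p i => c i l p))
      (h.mono fun i hi => (hc i hi).2 l hl)

/-- Every Keisler measure has an extension for which every condition holds that holds for some
further extension. -/
theorem exists_existentially_closed {M : Type w} [L.Structure M] [Nonempty M]
    (μ : KeislerMeasure L M n) : ∃ E : MeasureExtension.{u, v, w} μ,
      ∀ (E' : MeasureExtension.{u, v, max u v w} E.ν) (C : Condition L n),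
        C.Holds E'.ν → C.Holds E.ν := by
  -- Zorn's lemma is applied to sets of conditions that hold jointly in some extension, not to
  -- extensions: unions of chains are realized by ultraproducts, and the index types stay in the
  -- universe of the language.
  obtain ⟨W, hW⟩ := zorn_subset
    {W : Set (Condition L n) | ∃ E : MeasureExtension.{u, v, w} μ, ∀ C ∈ W, C.Holds E.ν}
    fun c hc hchain => by
      rcases c.eq_empty_or_nonempty with rfl | hne
      · exact ⟨∅, ⟨MeasureExtension.ultrapower (I := PUnit) (pure PUnit.unit) μ (fun _ => μ)
          fun _ => Eventually.of_forall fun _ => rfl, by simp⟩, by simp⟩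
      · have : Nonempty c := hne.to_subtype
        have : IsDirectedOrder c := ⟨fun a b => by
          rcases hchain.total a.2 b.2 with h | h
          · exact ⟨b, h, le_rfl⟩
          · exact ⟨a, le_rfl, h⟩⟩
        choose E hE using fun W : c => hc W.2
        refine ⟨⋃₀ c, ⟨MeasureExtension.ultraproduct (Ultrafilter.of atTop) E, ?_⟩,
          fun W hW => Set.subset_sUnion_of_mem hW⟩
        rintro C ⟨W, hW, hCW⟩
        exact Condition.Holds.ultraproduct (Ultrafilter.of_le atTop
          ((eventually_ge_atTop (⟨W, hW⟩ : c)).mono fun W' hW' => hE W' C (hW' hCW)))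
  obtain ⟨E, hE⟩ := hW.prop
  refine ⟨E, fun E' C hC => hE C ?_⟩
  refine hW.le_of_ge (y := insert C W) ⟨E.comp E', fun D hD => ?_⟩ (Set.subset_insert C W)
    (Set.mem_insert C W)
  rcases Set.mem_insert_iff.1 hD with rfl | hD
  · exact hC
  · exact (hE D hD).extends E'.ext

end Existential

/-- In an existentially closed extension a covering by small sets found in a further extension
already exists. Passing to a non-strict bound loses strictness, so the further extension is taken
for `ε / 2`. -/
theorem exists_isNTP2Smooth_extension {T : L.Theory} (hT : IsNTP2 T) {M : Type w} [L.Structure M]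
    [Nonempty M] [M ⊨ T] {n : ℕ} (μ : KeislerMeasure L M n) :
    ∃ E : MeasureExtension.{u, v, w} μ, E.ν.IsNTP2Smooth := by
  obtain ⟨E, hE⟩ := exists_existentially_closed μ
  have : Nonempty E.N := E.nonempty
  have : E.N ⊨ T := (E.f.theory_model_iff T).1 inferInstance
  refine ⟨E, isNTP2Smooth_of_not_hasLargeSparse fun m φ k ε hε hlarge => ?_⟩
  have hhalf : HasLargeSparse E.ν φ k (ε / 2) := fun K F hF =>
    hlarge K F fun X hX => (hF X hX).trans (half_lt_self hε)
  obtain ⟨E', hE'⟩ := exists_extension_not_hasLargeSparse E.ν φ (hT n m φ) k (half_pos hε) hhalf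
  have : Nonempty E'.N := E'.nonempty
  obtain ⟨K, r, d, X, c, hc, hX⟩ := exists_covering_of_not_hasLargeSparse hE'
  obtain ⟨c', hc', hX'⟩ := hE E' ⟨r, d, X, coveringFormula φ k K r X, ε / 2⟩
    ⟨c, hc, fun l hl => (hX l hl).le⟩
  exact not_hasLargeSparse_of_covering hc'
    (fun l hl => lt_of_le_of_lt (hX' l hl) (half_lt_self hε)) hlarge

end KeislerNTP2

theorem theorem3p8 {L : FirstOrder.Language.{u, v}} (T : L.Theory) (hT : T.IsComplete)
    (hNTP2 : KeislerNTP2.IsNTP2 T) (M : Type w) [L.Structure M] [Nonempty M] [M ⊨ T] (n : ℕ)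
    (μ : KeislerNTP2.KeislerMeasure L M n) :
    ∃ (N : Type (max u v w)) (_ : L.Structure N) (f : M ↪ₑ[L] N)
      (ν : KeislerNTP2.KeislerMeasure L N n), ν.Extends f μ ∧ ν.IsNTP2Smooth := by
  have ⟨E, hE⟩ := KeislerNTP2.exists_isNTP2Smooth_extension hNTP2 μ
  exact ⟨E.N, E.str, E.f, E.ν, E.ext, hE⟩
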